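/- All Banach spaces are complex. $\mathcal B(X)$ denotes the algebra of bounded linear operators on $X$ with the operator norm, and a character of $\mathcal B(X)$ is a unital algebra homomorphism $\mathcal B(X)\to\mathbb C$. (a) Let $X$ be a Banach space with $\dim X\neq 1$, let $\chi$ be a character of $\mathcal B(X)$, and let $Z$ be a non-zero Banach space. Then $$\phi\colon \mathcal B(X)\to\mathcal B(X\oplus Z),\qquad \phi(T)(x,z)=(Tx,\ \chi(T)z)$$ is a continuous injective algebra homomorphism with $\phi(I_X)=I_{X\oplus Z}$. It maps rank-one operators to rank-one operators, and it is not surjective. (b) Let $X$ be either the $p$-th James space $\mathcal J_p$ for some $1<p<\infty$, or the Semadeni space $C[0,\omega_1]$ of continuous complex functions, with the supremum norm, on the ordinal interval $[0,\omega_1]$ with its order topology, where $\omega_1$ is the first uncountable ordinal. Then there is a continuous injective algebra homomorphism $\phi\colon\mathcal B(X)\to\mathcal B(X)$ with $\phi(I_X)=I_X$ which maps rank-one operators to rank-one operators and is not surjective. Here $\mathcal J_p$ is the space of all complex sequences $x=(x_i)_{i\ge 0}$ with $x_i\to 0$ for which $$\|x\|=2^{-1/p}\sup\Bigl(|x_{k_n}-x_{k_0}|^p+\sum_{i=1}^{n}|x_{k_i}-x_{k_{i-1}}|^p\Bigr)^{1/p}$$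 is finite, the supremum being over all $n\ge 0$ and all integers $0\le k_0<k_1<\dots<k_n$. -/

import Mathlib

open Filter Topology

noncomputable section

/-- A bounded operator has rank one if its range is a one-dimensional subspace. -/
def IsRankOne {E F : Type*} [NormedAddCommGroup E] [NormedSpace ℂ E]
    [NormedAddCommGroup F] [NormedSpace ℂ F] (T : E →L[ℂ] F) : Prop :=
  Module.finrank ℂ (LinearMap.range (T : E →ₗ[ℂ] F)) = 1

/-- The cyclic `p`-variation of the sequence `x` along `k 0, k 1, …, k n`:
`(|x (k 1) - x (k 0)|^p + … + |x (k n) - x (k (n-1))|^p + |x (k 0) - x (k n)|^p)^(1/p)`.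
The last summand is the one with `i = n`, because `i + 1` is computed modulo `n + 1`. -/
def jamesVariation (p : ℝ) {n : ℕ} (k : Fin (n + 1) → ℕ) (x : ℕ → ℂ) : ℝ :=
  (∑ i, ‖x (k (i + 1)) - x (k i)‖ ^ p) ^ (1 / p)

/-- All cyclic `p`-variations of `x` along finite strictly increasing sequences of indices. -/
def jamesVariations (p : ℝ) (x : ℕ → ℂ) : Set ℝ :=
  {r | ∃ (n : ℕ) (k : Fin (n + 1) → ℕ), StrictMono k ∧ r = jamesVariation p k x}

theorem jamesVariations_nonempty (p : ℝ) (x : ℕ → ℂ) : (jamesVariations p x).Nonempty :=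
  ⟨_, 0, fun i => i, fun _ _ h => h, rfl⟩

theorem jamesVariation_nonneg (p : ℝ) {n : ℕ} (k : Fin (n + 1) → ℕ) (x : ℕ → ℂ) :
    0 ≤ jamesVariation p k x := by
  unfold jamesVariation
  positivity

theorem jamesVariation_zero {p : ℝ} (hp : 1 < p) {n : ℕ} (k : Fin (n + 1) → ℕ) :
    jamesVariation p k 0 = 0 := by
  have h0 : p ≠ 0 := by linarith
  simp [jamesVariation, Real.zero_rpow h0, Real.zero_rpow (inv_ne_zero h0)]

theorem jamesVariation_smul {p : ℝ} (hp : 1 < p) {n : ℕ} (k : Fin (n + 1) → ℕ) (c : ℂ)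
    (x : ℕ → ℂ) : jamesVariation p k (c • x) = ‖c‖ * jamesVariation p k x := by
  have h0 : p ≠ 0 := by linarith
  unfold jamesVariation
  have : ∀ i, ‖(c • x) (k (i + 1)) - (c • x) (k i)‖ ^ p
      = ‖c‖ ^ p * ‖x (k (i + 1)) - x (k i)‖ ^ p := fun i => by
    rw [Pi.smul_apply, Pi.smul_apply, ← smul_sub, norm_smul,
      Real.mul_rpow (norm_nonneg _) (norm_nonneg _)]
  simp_rw [this]
  rw [← Finset.mul_sum, Real.mul_rpow (by positivity) (by positivity), one_div,
    Real.rpow_rpow_inv (norm_nonneg _) h0]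

theorem jamesVariation_add_le {p : ℝ} (hp : 1 < p) {n : ℕ} (k : Fin (n + 1) → ℕ)
    (x y : ℕ → ℂ) :
    jamesVariation p k (x + y) ≤ jamesVariation p k x + jamesVariation p k y := by
  unfold jamesVariation
  refine le_trans ?_ (Real.Lp_add_le_of_nonneg (s := Finset.univ) hp.le
    (fun i _ => norm_nonneg (x (k (i + 1)) - x (k i)))
    (fun i _ => norm_nonneg (y (k (i + 1)) - y (k i))))
  have h : ∀ i, ‖(x + y) (k (i + 1)) - (x + y) (k i)‖
      ≤ ‖x (k (i + 1)) - x (k i)‖ + ‖y (k (i + 1)) - y (k i)‖ := fun i => by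
    rw [Pi.add_apply, Pi.add_apply, add_sub_add_comm]
    exact norm_add_le _ _
  have hp' : 0 ≤ p := by linarith
  gcongr with i
  exact h i

/-- The vector space underlying the `p`-th James space: the complex sequences which tend to zero
and whose cyclic `p`-variations are bounded. -/
def jamesSubmodule (p : ℝ) [hp : Fact (1 < p)] : Submodule ℂ (ℕ → ℂ) where
  carrier := {x | Tendsto x atTop (𝓝 0) ∧ BddAbove (jamesVariations p x)}
  zero_mem' := by
    refine ⟨tendsto_const_nhds, 0, ?_⟩
    rintro _ ⟨n, k, -, rfl⟩
    exact (jamesVariation_zero hp.out k).le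
  add_mem' := by
    rintro x y ⟨hx, a, ha⟩ ⟨hy, b, hb⟩
    refine ⟨(add_zero (0 : ℂ)) ▸ hx.add hy, a + b, ?_⟩
    rintro _ ⟨n, k, hk, rfl⟩
    exact (jamesVariation_add_le hp.out k x y).trans
      (add_le_add (ha ⟨n, k, hk, rfl⟩) (hb ⟨n, k, hk, rfl⟩))
  smul_mem' := by
    rintro c x ⟨hx, a, ha⟩
    refine ⟨(smul_zero c : c • (0 : ℂ) = 0) ▸ hx.const_smul c, ‖c‖ * a, ?_⟩
    rintro _ ⟨n, k, hk, rfl⟩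
    rw [jamesVariation_smul hp.out]
    exact mul_le_mul_of_nonneg_left (ha ⟨n, k, hk, rfl⟩) (norm_nonneg c)

/-- The `p`-th James space (over the complex numbers). -/
def JamesSpace (p : ℝ) [Fact (1 < p)] : Type := jamesSubmodule p

namespace JamesSpace

theorem two_rpow_mul (p : ℝ) : (2 : ℝ) ^ (-(1 / p)) * (2 : ℝ) ^ (1 / p) = 1 := by
  rw [← Real.rpow_add two_pos, neg_add_cancel, Real.rpow_zero]

variable {p : ℝ} [hp : Fact (1 < p)]

instance : AddCommGroup (JamesSpace p) := inferInstanceAs (AddCommGroup (jamesSubmodule p))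
instance : Module ℂ (JamesSpace p) := inferInstanceAs (Module ℂ (jamesSubmodule p))

/-- The terms of an element of the James space. -/
def seq (x : JamesSpace p) : ℕ → ℂ := x.1

/-- The James norm: the supremum of the cyclic `p`-variations, normalised so that the unit
vectors have norm one. -/
instance : Norm (JamesSpace p) := ⟨fun x => (2 : ℝ) ^ (-(1 / p)) * sSup (jamesVariations p x.seq)⟩

theorem norm_def (x : JamesSpace p) :
    ‖x‖ = (2 : ℝ) ^ (-(1 / p)) * sSup (jamesVariations p x.seq) := rfl

theorem ext {x y : JamesSpace p} (h : ∀ i, x.seq i = y.seq i) : x = y :=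
  Subtype.ext (funext h)

theorem tendsto_seq (x : JamesSpace p) : Tendsto x.seq atTop (𝓝 0) := x.2.1

theorem variation_le (x : JamesSpace p) {n : ℕ} {k : Fin (n + 1) → ℕ} (hk : StrictMono k) :
    (2 : ℝ) ^ (-(1 / p)) * jamesVariation p k x.seq ≤ ‖x‖ := by
  rw [norm_def]
  exact mul_le_mul_of_nonneg_left (le_csSup x.2.2 ⟨n, k, hk, rfl⟩) (by positivity)

theorem norm_le_of_variation_le {x : JamesSpace p} {C : ℝ}
    (h : ∀ (n : ℕ) (k : Fin (n + 1) → ℕ), StrictMono k →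
      (2 : ℝ) ^ (-(1 / p)) * jamesVariation p k x.seq ≤ C) : ‖x‖ ≤ C := by
  have h2 : (0 : ℝ) < 2 ^ (-(1 / p)) := by positivity
  rw [norm_def, ← le_div_iff₀' h2]
  refine csSup_le (jamesVariations_nonempty p _) ?_
  rintro _ ⟨n, k, hk, rfl⟩
  rw [le_div_iff₀' h2]
  exact h n k hk

theorem norm_sub_seq_le (x : JamesSpace p) {i j : ℕ} (hij : i < j) :
    ‖x.seq j - x.seq i‖ ≤ ‖x‖ := by
  have hk : StrictMono (![i, j] : Fin (1 + 1) → ℕ) := by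
    intro a b hab
    fin_cases a <;> fin_cases b <;> simp_all
  have h0 : p ≠ 0 := by have := hp.out; linarith
  have h := variation_le x hk
  have e : jamesVariation p (![i, j] : Fin (1 + 1) → ℕ) x.seq
      = 2 ^ (1 / p) * ‖x.seq j - x.seq i‖ := by
    unfold jamesVariation
    rw [Fin.sum_univ_two]
    have e1 : ((1 : Fin (1 + 1)) + 1) = 0 := rfl
    rw [zero_add, e1]
    simp only [Matrix.cons_val_zero, Matrix.cons_val_one]
    rw [norm_sub_rev (x.seq i), ← two_mul, Real.mul_rpow two_pos.le (by positivity), one_div,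
      Real.rpow_rpow_inv (norm_nonneg _) h0]
  rwa [e, ← mul_assoc, two_rpow_mul, one_mul] at h

theorem norm_seq_le (x : JamesSpace p) (i : ℕ) : ‖x.seq i‖ ≤ ‖x‖ := by
  have h : Tendsto (fun j => ‖x.seq j - x.seq i‖) atTop (𝓝 ‖0 - x.seq i‖) :=
    (x.tendsto_seq.sub_const _).norm
  rw [zero_sub, norm_neg] at h
  exact le_of_tendsto h ((eventually_gt_atTop i).mono fun j hj => norm_sub_seq_le x hj)

theorem core : NormedSpace.Core ℂ (JamesSpace p) where
  norm_nonneg x := (norm_nonneg _).trans (norm_seq_le x 0)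
  norm_smul c x := by
    have hle : ∀ (c : ℂ) (x : JamesSpace p), ‖c • x‖ ≤ ‖c‖ * ‖x‖ := fun c x =>
      norm_le_of_variation_le fun n k hk => by
        have e : jamesVariation p k (c • x).seq = ‖c‖ * jamesVariation p k x.seq :=
          jamesVariation_smul hp.out k c x.seq
        rw [e, mul_left_comm]
        exact mul_le_mul_of_nonneg_left (variation_le x hk) (norm_nonneg c)
    refine le_antisymm (hle c x) ?_
    rcases eq_or_ne c 0 with rfl | hc
    · rw [norm_zero, zero_mul]
      exact (norm_nonneg _).trans (norm_seq_le _ 0)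
    · have h := hle c⁻¹ (c • x)
      rw [smul_smul, inv_mul_cancel₀ hc, one_smul, norm_inv] at h
      rwa [← le_inv_mul_iff₀ (norm_pos_iff.2 hc)]
  norm_triangle x y := norm_le_of_variation_le fun n k hk => by
    have h : jamesVariation p k (x + y).seq ≤ jamesVariation p k x.seq + jamesVariation p k y.seq :=
      jamesVariation_add_le hp.out k x.seq y.seq
    calc _ ≤ (2 : ℝ) ^ (-(1 / p)) * (jamesVariation p k x.seq + jamesVariation p k y.seq) :=
          mul_le_mul_of_nonneg_left h (by positivity)
      _ ≤ ‖x‖ + ‖y‖ := by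
          rw [mul_add]
          exact add_le_add (variation_le x hk) (variation_le y hk)
  norm_eq_zero_iff x := by
    constructor
    · intro h
      refine ext fun i => ?_
      have h' := norm_seq_le x i
      rw [h] at h'
      exact norm_le_zero_iff.1 h'
    · rintro rfl
      refine le_antisymm (norm_le_of_variation_le fun n k _ => ?_)
        ((norm_nonneg _).trans (norm_seq_le _ 0))
      have e : jamesVariation p k (0 : JamesSpace p).seq = 0 := jamesVariation_zero hp.out k
      rw [e, mul_zero]

instance : NormedAddCommGroup (JamesSpace p) := NormedAddCommGroup.ofCore core
instance : NormedSpace ℂ (JamesSpace p) := NormedSpace.ofCore core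

instance : CompleteSpace (JamesSpace p) := by
  refine Metric.complete_of_cauchySeq_tendsto fun u hu => ?_
  have hsub : ∀ a b : JamesSpace p, (a - b).seq = a.seq - b.seq := fun _ _ => rfl
  have hpt : ∀ i, ∃ l, Tendsto (fun m => (u m).seq i) atTop (𝓝 l) := fun i => by
    refine cauchySeq_tendsto_of_complete (Metric.cauchySeq_iff.2 fun ε hε => ?_)
    obtain ⟨N, hN⟩ := Metric.cauchySeq_iff.1 hu ε hε
    refine ⟨N, fun m hm n hn => lt_of_le_of_lt ?_ (hN m hm n hn)⟩
    rw [dist_eq_norm, dist_eq_norm]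
    exact norm_seq_le (u m - u n) i
  choose l hl using hpt
  have hp0 : 0 < p := by have := hp.out; linarith
  have hvar : ∀ (m n : ℕ) (k : Fin (n + 1) → ℕ),
      Tendsto (fun m' => jamesVariation p k ((u m').seq - (u m).seq)) atTop
        (𝓝 (jamesVariation p k (l - (u m).seq))) := fun m n k => by
    unfold jamesVariation
    have h1 : ∀ i, Tendsto (fun m' => ((u m').seq - (u m).seq) i) atTop
        (𝓝 ((l - (u m).seq) i)) := fun i => (hl i).sub_const _
    exact (tendsto_finsetSum _ fun i _ => (((h1 _).sub (h1 _)).norm.rpow_const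
      (Or.inr hp0.le))).rpow_const (Or.inr (by positivity))
  have hbound : ∀ ε > 0, ∃ N, ∀ m ≥ N, ∀ (n : ℕ) (k : Fin (n + 1) → ℕ), StrictMono k →
      (2 : ℝ) ^ (-(1 / p)) * jamesVariation p k (l - (u m).seq) ≤ ε := fun ε hε => by
    obtain ⟨N, hN⟩ := Metric.cauchySeq_iff.1 hu ε hε
    refine ⟨N, fun m hm n k hk => ?_⟩
    refine le_of_tendsto ((hvar m n k).const_mul _) ((eventually_ge_atTop N).mono fun m' hm' => ?_)
    have h := (variation_le (u m' - u m) hk).trans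
      ((dist_eq_norm (u m') (u m)).symm.trans_lt (hN m' hm' m hm)).le
    rwa [hsub] at h
  have hunif : TendstoUniformly (fun m => (u m).seq) l atTop := by
    refine Metric.tendstoUniformly_iff.2 fun ε hε => ?_
    obtain ⟨N, hN⟩ := Metric.cauchySeq_iff.1 hu (ε / 2) (half_pos hε)
    refine (eventually_ge_atTop N).mono fun m hm i => lt_of_le_of_lt ?_ (half_lt_self hε)
    refine le_of_tendsto ((hl i).dist tendsto_const_nhds)
      ((eventually_ge_atTop N).mono fun m' hm' => ?_)
    refine le_trans ?_ (hN m' hm' m hm).le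
    rw [dist_eq_norm, dist_eq_norm]
    exact norm_seq_le (u m' - u m) i
  have hl0 : Tendsto l atTop (𝓝 0) := by
    refine Metric.tendsto_atTop.2 fun ε hε => ?_
    obtain ⟨m, hm⟩ := (Metric.tendstoUniformly_iff.1 hunif (ε / 2) (half_pos hε)).exists
    obtain ⟨N, hN⟩ := Metric.tendsto_atTop.1 (u m).tendsto_seq (ε / 2) (half_pos hε)
    refine ⟨N, fun i hi => ?_⟩
    calc dist (l i) 0 ≤ dist (l i) ((u m).seq i) + dist ((u m).seq i) 0 := dist_triangle _ _ _
      _ < ε / 2 + ε / 2 := add_lt_add (hm i) (hN i hi)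
      _ = ε := add_halves ε
  have h2 : (0 : ℝ) < 2 ^ (-(1 / p)) := by positivity
  have hmem : l ∈ jamesSubmodule p := by
    obtain ⟨N, hN⟩ := hbound 1 one_pos
    have hd : l - (u N).seq ∈ jamesSubmodule p := by
      refine ⟨(sub_zero (0 : ℂ)) ▸ hl0.sub (u N).tendsto_seq, 1 / 2 ^ (-(1 / p)), ?_⟩
      rintro _ ⟨n, k, hk, rfl⟩
      rw [le_div_iff₀' h2]
      exact hN N le_rfl n k hk
    have := (jamesSubmodule p).add_mem hd (u N).2
    rwa [show l - (u N).seq + (u N).1 = l from sub_add_cancel _ _] at this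
  let L : JamesSpace p := ⟨l, hmem⟩
  refine ⟨L, Metric.tendsto_atTop.2 fun ε hε => ?_⟩
  obtain ⟨N, hN⟩ := hbound (ε / 2) (half_pos hε)
  refine ⟨N, fun m hm => lt_of_le_of_lt ?_ (half_lt_self hε)⟩
  rw [dist_comm, dist_eq_norm]
  exact norm_le_of_variation_le fun n k hk => hN m hm n k hk

end JamesSpace

/-- The Semadeni space `C[0, ω₁]` of continuous complex functions on the ordinal interval
`[0, ω₁]` with the order topology, `ω₁` being the first uncountable ordinal. It carries the
supremum norm. -/
abbrev SemadeniSpace : Type 1 := C(Set.Icc (0 : Ordinal.{0}) (Ordinal.omega 1), ℂ)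

end

/-!
If `χ` is a character of `B(X)`, the map `T ↦ T ⊕ χ(T)` is block diagonal, so it misses the
operators with a non-zero off-diagonal corner. When `dim X ≠ 1`, a rank-one operator factors
through an operator of square zero and is therefore annihilated by `χ`, so its image still has rank
one (`isRankOne_diagAlgHom`). If moreover `X` is isomorphic to `X ⊕ ℂ`, conjugation turns this map
into an endomorphism of `B(X)` (`exists_algHom_of_equiv_prod`). Hence for the James and Semadeni
spaces it suffices to find such an isomorphism and a character.

The isomorphism is a shift: splitting off the first coordinate of a sequence in the James space,
and the homeomorphism of `[0, ω₁]` with `{0} ⊔ [1, ω₁] ≅ {0} ⊔ [0, ω₁]` for the Semadeni space.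

The characters come from elements `Λ` of the bidual outside `X` such that `X + ℂ Λ` is invariant
under all `T**`: an operator then acts on the line `(X + ℂ Λ) / X` by a scalar
(`exists_character_of_bidual`). For the James space `Λ` is the constant sequence `1`, the weak
limit of the partial sums of the unit vector basis; for the Semadeni space it is the indicator
function of `ω₁`, the weak limit of the indicators of the intervals `(α, ω₁]`. In both cases
`T** Λ` is first computed pointwise, and pointwise convergence is then upgraded to weak convergence
by a gliding hump argument (`tendsto_zero_of_gliding_hump`): a sum of `m` humps has norm
`O(m ^ (1 / p))` in the James space and `O(1)` in the Semadeni space, whereas a functional that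
does not tend to zero on the humps would be at least of order `m` on a suitably rotated sum.
-/

/-! ### Characters and rank-one operators -/

section RankOne

variable {E F : Type*} [NormedAddCommGroup E] [NormedSpace ℂ E]
  [NormedAddCommGroup F] [NormedSpace ℂ F]

theorem IsRankOne.exists_eq {T : E →L[ℂ] F} (hT : IsRankOne T) :
    ∃ (f : E →L[ℂ] ℂ) (y : F), y ≠ 0 ∧ ∀ x, T x = f x • y := by
  obtain ⟨⟨y, hy⟩, hy0, hspan⟩ := finrank_eq_one_iff'.1 hT
  have hy0' : y ≠ 0 := fun h => hy0 (Subtype.ext h)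
  obtain ⟨g, hg⟩ := SeparatingDual.exists_eq_one (R := ℂ) hy0'
  refine ⟨g.comp T, y, hy0', fun x => ?_⟩
  obtain ⟨c, hc⟩ := hspan ⟨T x, x, rfl⟩
  have hc' : c • y = T x := congrArg Subtype.val hc
  simp [← hc', hg]

/-- On a space of dimension other than one, a rank-one operator factors through a square-zero
operator, so every character annihilates it. -/
theorem AlgHom.apply_eq_zero_of_isRankOne (hE : Module.rank ℂ E ≠ 1)
    (χ : (E →L[ℂ] E) →ₐ[ℂ] ℂ) {T : E →L[ℂ] E} (hT : IsRankOne T) : χ T = 0 := by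
  obtain ⟨f, y, hy, hfy⟩ := hT.exists_eq
  have hz : ∃ z : E, z ∉ Submodule.span ℂ {y} := by
    by_contra! h
    refine hE (rank_eq_one y hy fun w => ?_)
    exact Submodule.mem_span_singleton.1 (h w)
  obtain ⟨z, hz⟩ := hz
  -- a functional vanishing at `y` but not at `z`
  obtain ⟨g, hgz, hgy⟩ : ∃ g : E →L[ℂ] ℂ, g z = 1 ∧ g y = 0 := by
    obtain ⟨a, ha⟩ := SeparatingDual.exists_eq_one (R := ℂ) hy
    have hne : z - a z • y ≠ 0 := fun h =>
      hz (Submodule.mem_span_singleton.2 ⟨a z, (sub_eq_zero.1 h).symm⟩)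
    obtain ⟨b, hb⟩ := SeparatingDual.exists_eq_one (R := ℂ) hne
    refine ⟨b - b y • a, ?_, ?_⟩
    · rw [map_sub, map_smul] at hb
      simp only [sub_apply, smul_apply, smul_eq_mul] at hb ⊢
      rw [← hb]
      ring
    · simp [ha]
  let A : E →L[ℂ] E := g.smulRight y
  let B : E →L[ℂ] E := f.smulRight z
  have hA : A * A = 0 := by
    ext x
    simp [A, hgy]
  have hAB : T = A * B := by
    ext x
    simp [A, B, hfy, hgz]
  have hχA : χ A = 0 := by
    have h := map_mul χ A A
    rw [hA, map_zero] at h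
    exact mul_self_eq_zero.1 h.symm
  rw [hAB, map_mul, hχA, zero_mul]

end RankOne

/-- The diagonal homomorphism `T ↦ T ⊕ χ(T)` determined by a character `χ`. -/
def diagAlgHom {X : Type*} [NormedAddCommGroup X] [NormedSpace ℂ X]
    (Z : Type*) [NormedAddCommGroup Z] [NormedSpace ℂ Z] (χ : (X →L[ℂ] X) →ₐ[ℂ] ℂ) :
    (X →L[ℂ] X) →ₐ[ℂ] ((X × Z) →L[ℂ] (X × Z)) :=
  AlgHom.ofLinearMap
    { toFun := fun T => T.prodMap (χ T • ContinuousLinearMap.id ℂ Z)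
      map_add' := fun S T => by ext <;> simp [add_smul]
      map_smul' := fun c T => by ext <;> simp [mul_smul] }
    (by ext <;> simp)
    (fun S T => by ext <;> simp [mul_smul])

section Diag

variable {X : Type*} [NormedAddCommGroup X] [NormedSpace ℂ X]
  {Z : Type*} [NormedAddCommGroup Z] [NormedSpace ℂ Z] (χ : (X →L[ℂ] X) →ₐ[ℂ] ℂ)

theorem diagAlgHom_apply (T : X →L[ℂ] X) (x : X) (z : Z) :
    diagAlgHom Z χ T (x, z) = (T x, χ T • z) := rfl

theorem continuous_diagAlgHom [CompleteSpace X] : Continuous (diagAlgHom Z χ) := by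
  have hχ : Continuous χ := map_continuous χ
  have h : (diagAlgHom Z χ : (X →L[ℂ] X) → _) = fun T =>
      (ContinuousLinearMap.inl ℂ X Z).comp (T.comp (ContinuousLinearMap.fst ℂ X Z)) +
        χ T • (ContinuousLinearMap.inr ℂ X Z).comp (ContinuousLinearMap.snd ℂ X Z) := by
    funext T
    ext <;> simp [diagAlgHom_apply]
  rw [h]
  fun_prop

theorem injective_diagAlgHom : Function.Injective (diagAlgHom Z χ) := by
  intro S T h
  ext x
  exact congrArg Prod.fst (DFunLike.congr_fun h (x, (0 : Z)))

theorem isRankOne_diagAlgHom (hX : Module.rank ℂ X ≠ 1) {T : X →L[ℂ] X} (hT : IsRankOne T) :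
    IsRankOne (diagAlgHom Z χ T) := by
  have hχ := AlgHom.apply_eq_zero_of_isRankOne hX χ hT
  have h : LinearMap.range (diagAlgHom Z χ T : X × Z →ₗ[ℂ] X × Z)
      = (LinearMap.range (T : X →ₗ[ℂ] X)).map (LinearMap.inl ℂ X Z) := by
    ext ⟨a, b⟩
    simp [diagAlgHom_apply, hχ, eq_comm]
  rw [IsRankOne, h, ← (Submodule.equivMapOfInjective _ LinearMap.inl_injective _).finrank_eq]
  exact hT

theorem not_surjective_diagAlgHom [Nontrivial Z] :
    ¬ Function.Surjective (diagAlgHom Z χ) := by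
  intro hs
  -- a character exists, so `B(X) ≠ 0` and hence `X ≠ 0`
  have hX : Nontrivial X := by
    by_contra h
    rw [not_nontrivial_iff_subsingleton] at h
    have h1 := map_one χ
    rw [Subsingleton.elim (1 : X →L[ℂ] X) 0, map_zero] at h1
    exact zero_ne_one h1
  obtain ⟨x, hx⟩ := exists_ne (0 : X)
  obtain ⟨z, hz⟩ := exists_ne (0 : Z)
  obtain ⟨f, hf⟩ := SeparatingDual.exists_eq_one (R := ℂ) hx
  obtain ⟨T, hT⟩ := hs ((ContinuousLinearMap.inr ℂ X Z).comp
    ((f.smulRight z).comp (ContinuousLinearMap.fst ℂ X Z)))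
  have h := congrArg Prod.snd (DFunLike.congr_fun hT (x, (0 : Z)))
  simp [diagAlgHom_apply, hf] at h
  exact hz h.symm

end Diag

/-! ### Spaces isomorphic to their sum with a line -/

theorem Module.rank_ne_one_of_linearEquiv_prod {X : Type*} [AddCommGroup X] [Module ℂ X]
    (e : X ≃ₗ[ℂ] X × ℂ) : Module.rank ℂ X ≠ 1 := by
  intro h
  have h1 : Module.finrank ℂ X = 1 := by rw [Module.finrank, h, map_one]
  have : FiniteDimensional ℂ X := Module.finite_of_finrank_eq_succ h1
  have h2 := e.finrank_eq
  rw [Module.finrank_prod, h1, Module.finrank_self] at h2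
  omega

/-- If `X` is isomorphic to `X ⊕ ℂ` and `B(X)` has a character, conjugating the diagonal
homomorphism by the isomorphism gives a non-surjective endomorphism of `B(X)`. -/
theorem exists_algHom_of_equiv_prod {X : Type*} [NormedAddCommGroup X] [NormedSpace ℂ X]
    [CompleteSpace X] (e : X ≃L[ℂ] X × ℂ) (χ : (X →L[ℂ] X) →ₐ[ℂ] ℂ) :
    ∃ φ : (X →L[ℂ] X) →ₐ[ℂ] (X →L[ℂ] X),
      Continuous φ ∧ Function.Injective φ ∧
      φ (ContinuousLinearMap.id ℂ X) = ContinuousLinearMap.id ℂ X ∧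
      (∀ T : X →L[ℂ] X, IsRankOne T → IsRankOne (φ T)) ∧ ¬ Function.Surjective φ := by
  let ψ := e.symm.conjContinuousAlgEquiv
  refine ⟨ψ.toAlgEquiv.toAlgHom.comp (diagAlgHom ℂ χ), ?_, ?_, map_one _, ?_, ?_⟩
  · exact ψ.continuous.comp (continuous_diagAlgHom χ)
  · exact ψ.injective.comp (injective_diagAlgHom χ)
  · intro T hT
    have h := isRankOne_diagAlgHom (Z := ℂ) χ
      (Module.rank_ne_one_of_linearEquiv_prod e.toLinearEquiv) hT
    have hr : LinearMap.range (ψ (diagAlgHom ℂ χ T) : X →ₗ[ℂ] X)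
        = (LinearMap.range (diagAlgHom ℂ χ T : X × ℂ →ₗ[ℂ] X × ℂ)).map
            (e.symm.toLinearEquiv : X × ℂ →ₗ[ℂ] X) := by
      ext x
      simp only [LinearMap.mem_range, Submodule.mem_map]
      constructor
      · rintro ⟨y, rfl⟩
        exact ⟨_, ⟨e y, rfl⟩, rfl⟩
      · rintro ⟨_, ⟨y, rfl⟩, rfl⟩
        refine ⟨e.symm y, ?_⟩
        simp [ψ, ContinuousLinearEquiv.conjContinuousAlgEquiv_apply]
    change Module.finrank ℂ (LinearMap.range (ψ (diagAlgHom ℂ χ T) : X →ₗ[ℂ] X)) = 1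
    rw [hr, LinearEquiv.finrank_map_eq]
    exact h
  · intro hs
    refine not_surjective_diagAlgHom (Z := ℂ) χ fun S => ?_
    obtain ⟨T, hT⟩ := hs (ψ S)
    exact ⟨T, ψ.injective hT⟩

/-! ### Characters from bidual elements -/

/-- Let `Λ` be a functional on the dual of `X` that is not evaluation at a point of `X`. If
`T** Λ ∈ X + ℂ Λ` for every operator `T`, then `T` acts on the line `(X + ℂ Λ) / X` as a scalar,
and this scalar is a character of `B(X)`. -/
theorem exists_character_of_bidual {X : Type*} [NormedAddCommGroup X] [NormedSpace ℂ X]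
    (Λ : (X →L[ℂ] ℂ) →ₗ[ℂ] ℂ) (hΛ : ∀ z : X, ∃ f : X →L[ℂ] ℂ, Λ f ≠ f z)
    (h : ∀ T : X →L[ℂ] X, ∃ (c : ℂ) (z : X), ∀ f : X →L[ℂ] ℂ,
      Λ (f.comp T) = c * Λ f + f z) :
    Nonempty ((X →L[ℂ] X) →ₐ[ℂ] ℂ) := by
  choose χ z hχ using h
  have huniq : ∀ (T : X →L[ℂ] X) (c : ℂ) (w : X),
      (∀ f : X →L[ℂ] ℂ, Λ (f.comp T) = c * Λ f + f w) → χ T = c := by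
    intro T c w hc
    by_contra hne
    have hne' : χ T - c ≠ 0 := sub_ne_zero.2 hne
    obtain ⟨f, hf⟩ := hΛ ((χ T - c)⁻¹ • (w - z T))
    refine hf ?_
    have h1 := (hχ T f).symm.trans (hc f)
    rw [map_smul, map_sub, smul_eq_mul, eq_inv_mul_iff_mul_eq₀ hne']
    linear_combination h1
  refine ⟨AlgHom.ofLinearMap
    { toFun := χ
      map_add' := fun S T => huniq _ _ (z S + z T) fun f => ?_
      map_smul' := fun a T => huniq _ _ (a • z T) fun f => ?_ }
    (huniq _ _ 0 fun f => ?_)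
    (fun S T => huniq _ _ (χ T • z S + S (z T)) fun f => ?_)⟩
  · rw [ContinuousLinearMap.comp_add, map_add, hχ, hχ, map_add]
    ring
  · rw [ContinuousLinearMap.comp_smul, map_smul, hχ, map_smul]
    simp only [smul_eq_mul, RingHom.id_apply]
    ring
  · rw [map_zero, add_zero, one_mul]
    rfl
  · have e : f.comp (S * T) = (f.comp S).comp T := rfl
    rw [e, hχ T, hχ S]
    simp only [map_add, map_smul, smul_eq_mul, ContinuousLinearMap.comp_apply,
      LinearMap.coe_mk, AddHom.coe_mk]
    ring

/-- A character obtained from a weakly Cauchy family `s` without weak limit, provided that each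
`T (s i) - c • s i` converges weakly for a suitable scalar `c`. -/
theorem exists_character_of_weak_limits {X ι : Type*} [NormedAddCommGroup X] [NormedSpace ℂ X]
    (l : Filter ι) [l.NeBot] (s : ι → X)
    (hs : ∀ f : X →L[ℂ] ℂ, ∃ a, Tendsto (fun i => f (s i)) l (𝓝 a))
    (hlim : ∀ z : X, ∃ f : X →L[ℂ] ℂ, ¬ Tendsto (fun i => f (s i)) l (𝓝 (f z)))
    (h : ∀ T : X →L[ℂ] X, ∃ (c : ℂ) (z : X), ∀ f : X →L[ℂ] ℂ,
      Tendsto (fun i => f (T (s i) - c • s i - z)) l (𝓝 0)) :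
    Nonempty ((X →L[ℂ] X) →ₐ[ℂ] ℂ) := by
  choose Λ hΛ using hs
  refine exists_character_of_bidual
    { toFun := Λ
      map_add' := fun f g => tendsto_nhds_unique (hΛ (f + g)) ((hΛ f).add (hΛ g))
      map_smul' := fun a f => tendsto_nhds_unique (hΛ (a • f)) ((hΛ f).const_mul a) }
    (fun z => ?_) (fun T => ?_)
  · obtain ⟨f, hf⟩ := hlim z
    exact ⟨f, fun e => hf (e ▸ hΛ f)⟩
  · obtain ⟨c, z, hz⟩ := h T
    refine ⟨c, z, fun f => ?_⟩
    have h1 := ((hz f).add ((hΛ f).const_mul c)).add_const (f z)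
    rw [zero_add] at h1
    refine tendsto_nhds_unique (hΛ (f.comp T)) (h1.congr fun i => ?_)
    simp only [map_sub, map_smul, smul_eq_mul, ContinuousLinearMap.comp_apply]
    ring

/-! ### The gliding hump -/

/-- A gliding hump argument. Suppose that one can keep adding unimodular multiples of late members
of the family `u`, in such a way that sums of `m` members have norm `o(m)`. Then `u` tends weakly
to zero: otherwise some functional would be at least `m * δ` on such sums. The predicate
`P m w` describes the admissible sums `w` of `m` members. -/
theorem tendsto_zero_of_gliding_hump {X ι : Type*} [NormedAddCommGroup X] [NormedSpace ℂ X]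
    {l : Filter ι} {u : ι → X} (P : ℕ → X → Prop) {B : ℕ → ℝ}
    (hB : Tendsto (fun m : ℕ => B m / m) atTop (𝓝 0)) (h0 : P 0 0)
    (hstep : ∀ m w, P m w → ∀ᶠ i in l, ∀ c : ℂ, ‖c‖ = 1 → P (m + 1) (w + c • u i))
    (hP : ∀ m w, P m w → ‖w‖ ≤ B m) (f : X →L[ℂ] ℂ) :
    Tendsto (fun i => f (u i)) l (𝓝 0) := by
  by_contra hnot
  obtain ⟨δ, hδ, hfreq⟩ : ∃ δ > 0, ∃ᶠ i in l, δ ≤ ‖f (u i)‖ := by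
    rw [Metric.tendsto_nhds] at hnot
    push Not at hnot
    obtain ⟨δ, hδ, h⟩ := hnot
    exact ⟨δ, hδ, h.mono fun i hi => by simpa using hi⟩
  have key : ∀ m : ℕ, ∃ w, P m w ∧ m * δ ≤ (f w).re := by
    intro m
    induction m with
    | zero => exact ⟨0, h0, by simp⟩
    | succ m ih =>
      obtain ⟨w, hw, hre⟩ := ih
      obtain ⟨i, hi, hPi⟩ := (hfreq.and_eventually (hstep m w hw)).exists
      have hpos : (0 : ℝ) < ‖f (u i)‖ := hδ.trans_le hi
      -- rotate `u i` so that `f` takes a positive value there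
      obtain ⟨c, hc, hcf⟩ : ∃ c : ℂ, ‖c‖ = 1 ∧ c * f (u i) = (‖f (u i)‖ : ℂ) := by
        have hne : (‖f (u i)‖ : ℂ) ≠ 0 := by exact_mod_cast hpos.ne'
        refine ⟨(starRingEnd ℂ) (f (u i)) / ‖f (u i)‖, ?_, ?_⟩
        · rw [norm_div, RCLike.norm_conj, Complex.norm_real, norm_norm, div_self hpos.ne']
        · rw [div_mul_eq_mul_div, RCLike.conj_mul, div_eq_iff hne]
          simp [sq]
      refine ⟨w + c • u i, hPi c hc, ?_⟩
      rw [map_add, map_smul, smul_eq_mul, hcf, Complex.add_re, Complex.ofReal_re]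
      push_cast
      linarith
  have hbound : ∀ᶠ m : ℕ in atTop, δ ≤ ‖f‖ * (B m / m) := by
    filter_upwards [eventually_gt_atTop 0] with m hm
    obtain ⟨w, hw, hre⟩ := key m
    have hm' : (0 : ℝ) < m := by exact_mod_cast hm
    rw [← mul_div_assoc, le_div_iff₀ hm', mul_comm]
    exact hre.trans ((Complex.re_le_norm _).trans ((f.le_opNorm w).trans
      (mul_le_mul_of_nonneg_left (hP m w hw) (norm_nonneg f))))
  have := ge_of_tendsto (hB.const_mul ‖f‖) hbound
  rw [mul_zero] at this
  exact absurd this (not_le.2 hδ)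

/-! ### The linear `p`-variation of a sequence -/

/-- The linear (non-cyclic) `p`-variation of `x` along `k 0 < … < k n`, without the `p`-th root.
Indices are given by a function on all of `ℕ`, only the first `n + 1` values of which matter; this
makes it easy to concatenate, restrict and shift index sequences. -/
noncomputable def linVariation (p : ℝ) (x : ℕ → ℂ) (k : ℕ → ℕ) (n : ℕ) : ℝ :=
  ∑ i ∈ Finset.range n, ‖x (k (i + 1)) - x (k i)‖ ^ p

/-- The linear `p`-variations of `x` along all increasing sequences of indices are at
most `C`. -/
def LinVariationLE (p : ℝ) (x : ℕ → ℂ) (C : ℝ) : Prop :=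
  ∀ k : ℕ → ℕ, StrictMono k → ∀ n, linVariation p x k n ≤ C

section LinVariation

variable {p : ℝ} {x y : ℕ → ℂ} {C : ℝ}

theorem linVariation_nonneg (k : ℕ → ℕ) (n : ℕ) : 0 ≤ linVariation p x k n :=
  Finset.sum_nonneg fun _ _ => by positivity

theorem linVariation_add (k : ℕ → ℕ) (m n : ℕ) :
    linVariation p x k (m + n) = linVariation p x k m + linVariation p x (fun i => k (m + i)) n :=
  Finset.sum_range_add _ _ _

theorem linVariation_mono (k : ℕ → ℕ) {m n : ℕ} (h : m ≤ n) :
    linVariation p x k m ≤ linVariation p x k n := by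
  obtain ⟨d, rfl⟩ := Nat.exists_eq_add_of_le h
  rw [linVariation_add]
  exact le_add_of_nonneg_right (linVariation_nonneg _ _)

theorem LinVariationLE.nonneg (h : LinVariationLE p x C) : 0 ≤ C :=
  (linVariation_nonneg id 0).trans (h id strictMono_id 0)

/-- Index sequences can be joined. -/
theorem strictMono_join {k l : ℕ → ℕ} (hk : StrictMono k) (hl : StrictMono l) {n : ℕ}
    (h : k n < l 0) : StrictMono fun i => if i ≤ n then k i else l (i - (n + 1)) := by
  refine strictMono_nat_of_lt_succ fun i => ?_
  rcases lt_trichotomy i n with hi | rfl | hi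
  · simp only [hi.le, Nat.succ_le_of_lt hi, if_true]
    exact hk (Nat.lt_succ_self i)
  · simpa using h
  · simp only [show ¬ i ≤ n by omega, show ¬ i + 1 ≤ n by omega, if_false]
    exact hl (by omega)

theorem LinVariationLE.norm_sub_rpow_le (h : LinVariationLE p x C) {i j : ℕ} (hij : i < j) :
    ‖x j - x i‖ ^ p ≤ C := by
  have hk := strictMono_join (k := fun t => i + t) (l := fun t => j + t) (n := 0)
    (strictMono_id.const_add i) (strictMono_id.const_add j) (by simpa using hij)
  simpa [linVariation] using h _ hk 1

/-- Bounded linear `p`-variation forces small linear `p`-variation of the tails: append the index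
sequence in the tail to one along which the supremum is almost attained. -/
theorem LinVariationLE.exists_tail (h : LinVariationLE p x C) {ε : ℝ} (hε : 0 < ε) :
    ∃ N, ∀ l : ℕ → ℕ, StrictMono l → N ≤ l 0 → ∀ n, linVariation p x l n ≤ ε := by
  let S : Set ℝ := {r | ∃ k : ℕ → ℕ, StrictMono k ∧ ∃ n, r = linVariation p x k n}
  have hS : BddAbove S := ⟨C, by rintro _ ⟨k, hk, n, rfl⟩; exact h k hk n⟩
  have hne : S.Nonempty := ⟨_, id, strictMono_id, 0, rfl⟩
  obtain ⟨_, ⟨k, hk, n, rfl⟩, hlt⟩ := exists_lt_of_lt_csSup hne (sub_lt_self (sSup S) hε)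
  refine ⟨k n + 1, fun l hl hl0 m => ?_⟩
  have hj := strictMono_join hk hl (n := n) (by omega)
  have hle := le_csSup hS ⟨_, hj, n + 1 + m, rfl⟩
  rw [linVariation_add] at hle
  have h1 : linVariation p x k n ≤
      linVariation p x (fun i => if i ≤ n then k i else l (i - (n + 1))) (n + 1) := by
    refine le_trans (le_of_eq ?_) (linVariation_mono _ n.le_succ)
    refine Finset.sum_congr rfl fun i hi => ?_
    have hi' := Finset.mem_range.1 hi
    simp [hi'.le, Nat.succ_le_of_lt hi']
  have h2 : linVariation p x (fun i => if n + 1 + i ≤ n then k (n + 1 + i)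
      else l (n + 1 + i - (n + 1))) m = linVariation p x l m := by
    refine Finset.sum_congr rfl fun i _ => ?_
    simp [show ¬ n + 1 + i ≤ n by omega, show ¬ n + 1 + (i + 1) ≤ n by omega]
  rw [h2] at hle
  linarith

theorem LinVariationLE.exists_tendsto (hp : 0 < p) (h : LinVariationLE p x C) :
    ∃ c, Tendsto x atTop (𝓝 c) := by
  refine cauchySeq_tendsto_of_complete (Metric.cauchySeq_iff'.2 fun ε hε => ?_)
  obtain ⟨N, hN⟩ := h.exists_tail (Real.rpow_pos_of_pos (half_pos hε) p)
  refine ⟨N, fun n hn => ?_⟩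
  rcases hn.eq_or_lt with rfl | hlt
  · simpa using hε
  have hk := strictMono_join (k := fun t => N + t) (l := fun t => n + t) (n := 0)
    (strictMono_id.const_add N) (strictMono_id.const_add n) (by simpa using hlt)
  have h1 : ‖x n - x N‖ ^ p ≤ (ε / 2) ^ p := by
    simpa [linVariation] using hN _ hk (by simp) 1
  rw [dist_eq_norm]
  exact ((Real.rpow_le_rpow_iff (norm_nonneg _) (half_pos hε).le hp).1 h1).trans_lt
    (half_lt_self hε)

theorem LinVariationLE.of_tendsto {ι : Type*} {l : Filter ι} [l.NeBot] {u : ι → ℕ → ℂ}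
    (hp : 0 ≤ p) (hu : ∀ i, LinVariationLE p (u i) C)
    (hx : ∀ j, Tendsto (fun i => u i j) l (𝓝 (x j))) : LinVariationLE p x C := fun k hk n =>
  le_of_tendsto (tendsto_finsetSum _ fun _ _ => ((hx _).sub (hx _)).norm.rpow_const (Or.inr hp))
    (Eventually.of_forall fun i => hu i k hk n)

theorem LinVariationLE.sub_const (h : LinVariationLE p x C) (c : ℂ) :
    LinVariationLE p (fun i => x i - c) C := fun k hk n => by
  simpa [linVariation] using h k hk n

theorem add_rpow_le_two_rpow_mul (hp : 0 ≤ p) {a b : ℝ} (ha : 0 ≤ a) (hb : 0 ≤ b) :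
    (a + b) ^ p ≤ 2 ^ p * (a ^ p + b ^ p) := by
  wlog hab : a ≤ b generalizing a b
  · rw [add_comm a, add_comm (a ^ p)]
    exact this hb ha (le_of_not_ge hab)
  calc (a + b) ^ p ≤ (2 * b) ^ p := Real.rpow_le_rpow (by positivity) (by linarith) hp
    _ = 2 ^ p * b ^ p := Real.mul_rpow two_pos.le hb
    _ ≤ 2 ^ p * (a ^ p + b ^ p) := by
      gcongr
      exact le_add_of_nonneg_left (by positivity)

theorem linVariation_add_le (hp : 0 ≤ p) (k : ℕ → ℕ) (n : ℕ) :
    linVariation p (x + y) k n ≤ 2 ^ p * (linVariation p x k n + linVariation p y k n) := by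
  unfold linVariation
  rw [← Finset.sum_add_distrib, Finset.mul_sum]
  refine Finset.sum_le_sum fun i _ => ?_
  refine le_trans ?_ (add_rpow_le_two_rpow_mul hp (norm_nonneg _) (norm_nonneg _))
  refine Real.rpow_le_rpow (norm_nonneg _) ?_ hp
  rw [Pi.add_apply, Pi.add_apply, add_sub_add_comm]
  exact norm_add_le _ _

/-- The linear `p`-variation is controlled by splitting the index sequence at `N`: the part
below `N`, one crossing step, and the part from `N` on. -/
theorem linVariationLE_of_split {A B D : ℝ} (N : ℕ) (hA0 : 0 ≤ A) (hD0 : 0 ≤ D)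
    (hA : ∀ k : ℕ → ℕ, StrictMono k → ∀ n, (∀ i ≤ n, k i < N) → linVariation p x k n ≤ A)
    (hD : ∀ i j, ‖x j - x i‖ ^ p ≤ D)
    (hB : ∀ k : ℕ → ℕ, StrictMono k → N ≤ k 0 → ∀ n, linVariation p x k n ≤ B) :
    LinVariationLE p x (A + D + B) := by
  intro k hk n
  have hex : ∃ a, N ≤ k a := ⟨N, hk.id_le N⟩
  classical
  obtain ⟨a, ha, hmin⟩ : ∃ a, N ≤ k a ∧ ∀ i < a, k i < N :=
    ⟨Nat.find hex, Nat.find_spec hex, fun i hi => not_le.1 (Nat.find_min hex hi)⟩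
  have hhigh := hB (fun i => k (a + i)) (fun i j hij => hk (by omega)) (by simpa using ha) n
  refine (linVariation_mono k (Nat.le_add_left n a)).trans ?_
  rw [linVariation_add]
  refine add_le_add ?_ hhigh
  cases a with
  | zero => simpa [linVariation] using add_nonneg hA0 hD0
  | succ a =>
    rw [linVariation_add]
    refine add_le_add (hA k hk a fun i hi => hmin i (by omega)) ?_
    simpa [linVariation] using hD _ _

/-- Bounds below the split: perturbing finitely many terms of a sequence by a small amount raises
the linear `p`-variation along these terms by at most one. -/
theorem eventually_linVariation_add_le {ι : Type*} {l : Filter ι} {u : ι → ℕ → ℂ} (hp : 0 ≤ p)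
    (hx : LinVariationLE p x C) (hu : ∀ j, Tendsto (fun i => u i j) l (𝓝 0)) (N : ℕ) :
    ∀ᶠ i in l, ∀ c : ℂ, ‖c‖ = 1 → ∀ k : ℕ → ℕ, StrictMono k → ∀ n, (∀ t ≤ n, k t < N) →
      linVariation p (x + c • u i) k n ≤ C + 1 := by
  have hstep : ∀ s t : ℕ, ∀ᶠ i in l,
      (‖x t - x s‖ + ‖u i t - u i s‖) ^ p ≤ ‖x t - x s‖ ^ p + 1 / (N + 1) := by
    intro s t
    have h1 : Tendsto (fun i => (‖x t - x s‖ + ‖u i t - u i s‖) ^ p) l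
        (𝓝 (‖x t - x s‖ ^ p)) := by
      have := (((hu t).sub (hu s)).norm.const_add ‖x t - x s‖).rpow_const
        (p := p) (Or.inr hp)
      simpa using this
    exact (h1.eventually_lt_const (lt_add_of_pos_right _ (by positivity))).mono fun _ => le_of_lt
  have hall : ∀ᶠ i in l, ∀ s ∈ Finset.range N, ∀ t ∈ Finset.range N,
      (‖x t - x s‖ + ‖u i t - u i s‖) ^ p ≤ ‖x t - x s‖ ^ p + 1 / (N + 1) :=
    (Filter.eventually_all_finset _).2 fun s _ =>
      (Filter.eventually_all_finset _).2 fun t _ => hstep s t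
  filter_upwards [hall] with i hi c hc k hk n hn
  have hnN : n < N := (hk.id_le n).trans_lt (hn n le_rfl)
  have hterm : ∀ t ∈ Finset.range n, ‖(x + c • u i) (k (t + 1)) - (x + c • u i) (k t)‖ ^ p
      ≤ ‖x (k (t + 1)) - x (k t)‖ ^ p + 1 / (N + 1) := by
    intro t ht
    have ht' := Finset.mem_range.1 ht
    refine le_trans ?_ (hi (k t) (Finset.mem_range.2 (hn t ht'.le)) (k (t + 1))
      (Finset.mem_range.2 (hn (t + 1) ht')))
    refine Real.rpow_le_rpow (norm_nonneg _) ?_ hp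
    have e : (x + c • u i) (k (t + 1)) - (x + c • u i) (k t)
        = (x (k (t + 1)) - x (k t)) + c • (u i (k (t + 1)) - u i (k t)) := by
      simp only [Pi.add_apply, Pi.smul_apply, smul_sub]
      ring
    rw [e]
    refine (norm_add_le _ _).trans ?_
    rw [norm_smul, hc, one_mul]
  refine (Finset.sum_le_sum hterm).trans ?_
  rw [Finset.sum_add_distrib]
  refine add_le_add (hx k hk n) ?_
  rw [Finset.sum_const, Finset.card_range, nsmul_eq_mul, mul_one_div, div_le_one (by positivity)]
  exact_mod_cast (by omega : n ≤ N + 1)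

end LinVariation

/-! ### The James space -/

namespace JamesSpace

variable {p : ℝ} [hp : Fact (1 < p)]

theorem linVariationLE (x : JamesSpace p) : LinVariationLE p x.seq (2 * ‖x‖ ^ p) := by
  intro k hk n
  have hp0 : 0 < p := one_pos.trans hp.out
  have hkn : StrictMono (fun i : Fin (n + 1) => k i) := fun i j hij => hk hij
  have h := variation_le x hkn
  have hcyc : linVariation p x.seq k n ≤
      ∑ i : Fin (n + 1), ‖x.seq (k (i + 1 : Fin (n + 1))) - x.seq (k i)‖ ^ p := by
    rw [Fin.sum_univ_castSucc]
    refine le_add_of_le_of_nonneg (le_of_eq ?_) (by positivity)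
    rw [linVariation, Finset.sum_range]
    refine Finset.sum_congr rfl fun i _ => ?_
    rw [Fin.coeSucc_eq_succ, Fin.val_succ, Fin.val_castSucc]
  set V := ∑ i : Fin (n + 1), ‖x.seq (k (i + 1 : Fin (n + 1))) - x.seq (k i)‖ ^ p with hV
  have hV0 : 0 ≤ V := Finset.sum_nonneg fun _ _ => by positivity
  refine hcyc.trans ?_
  have h' : V ^ (1 / p) ≤ 2 ^ (1 / p) * ‖x‖ := by
    have h2 : (0 : ℝ) < 2 ^ (1 / p) := by positivity
    have := mul_le_mul_of_nonneg_left h h2.le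
    rwa [← mul_assoc, mul_comm ((2 : ℝ) ^ (1 / p)), two_rpow_mul, one_mul] at this
  have h3 := Real.rpow_le_rpow (by positivity) h' hp0.le
  rwa [Real.mul_rpow (by positivity) (norm_nonneg _), one_div, Real.rpow_inv_rpow hV0 hp0.ne',
    Real.rpow_inv_rpow two_pos.le hp0.ne'] at h3

theorem jamesVariation_le_of_linVariationLE {x : ℕ → ℂ} {C : ℝ} (h : LinVariationLE p x C)
    {n : ℕ} {k : Fin (n + 1) → ℕ} (hk : StrictMono k) :
    jamesVariation p k x ≤ (2 * C) ^ (1 / p) := by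
  have hp0 : 0 < p := one_pos.trans hp.out
  refine Real.rpow_le_rpow (Finset.sum_nonneg fun _ _ => by positivity) ?_ (by positivity)
  rw [Fin.sum_univ_castSucc, two_mul]
  refine add_le_add ?_ ?_
  · -- extend `k` to an increasing sequence on `ℕ`
    have hj := strictMono_join
      (k := fun i => if hi : i < n + 1 then k ⟨i, hi⟩ else k (Fin.last n) + i)
      (l := fun i => k (Fin.last n) + 1 + i) (n := n)
      (by
        refine strictMono_nat_of_lt_succ fun i => ?_
        rcases lt_trichotomy i n with hi | rfl | hi
        · simp only [show i < n + 1 by omega, show i + 1 < n + 1 by omega, dif_pos]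
          exact hk (Fin.mk_lt_mk.2 i.lt_succ_self)
        · simp [Fin.last]
        · simp [show ¬ i < n + 1 by omega, show ¬ i + 1 < n + 1 by omega])
      (strictMono_id.const_add _) (by simp [Fin.last])
    refine le_trans (le_of_eq ?_) (h _ hj n)
    rw [linVariation, Finset.sum_range]
    refine Finset.sum_congr rfl fun i _ => ?_
    have hi := i.2
    simp only [Fin.coeSucc_eq_succ, show (i : ℕ) + 1 ≤ n by omega, show (i : ℕ) ≤ n by omega,
      show (i : ℕ) + 1 < n + 1 by omega, show (i : ℕ) < n + 1 by omega, if_true, dif_pos]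
    rfl
  · rw [Fin.last_add_one, norm_sub_rev]
    rcases Nat.eq_zero_or_pos n with rfl | hn
    · rw [show Fin.last 0 = 0 from rfl, sub_self, norm_zero, Real.zero_rpow hp0.ne']
      exact h.nonneg
    · exact h.norm_sub_rpow_le (hk (by rw [Fin.lt_def]; simpa using hn))

theorem norm_le_of_linVariationLE {x : JamesSpace p} {C : ℝ} (h : LinVariationLE p x.seq C) :
    ‖x‖ ≤ C ^ (1 / p) := by
  refine norm_le_of_variation_le fun n k hk => ?_
  refine (mul_le_mul_of_nonneg_left (jamesVariation_le_of_linVariationLE h hk)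
    (by positivity)).trans ?_
  rw [Real.mul_rpow two_pos.le h.nonneg, ← mul_assoc, two_rpow_mul, one_mul]

/-- The element of the James space given by a null sequence of bounded linear `p`-variation. -/
def mk (x : ℕ → ℂ) (h0 : Tendsto x atTop (𝓝 0)) {C : ℝ} (h : LinVariationLE p x C) :
    JamesSpace p :=
  ⟨x, h0, (2 * C) ^ (1 / p), by
    rintro _ ⟨n, k, hk, rfl⟩
    exact jamesVariation_le_of_linVariationLE h hk⟩

theorem seq_mk (x : ℕ → ℂ) (h0 : Tendsto x atTop (𝓝 0)) {C : ℝ} (h : LinVariationLE p x C) :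
    (mk x h0 h).seq = x := rfl

theorem seq_zero : (0 : JamesSpace p).seq = 0 := rfl

/-- The coordinate functionals. -/
noncomputable def coord (p : ℝ) [Fact (1 < p)] (j : ℕ) : JamesSpace p →L[ℂ] ℂ :=
  LinearMap.mkContinuous
    { toFun := fun x => x.seq j
      map_add' := fun _ _ => rfl
      map_smul' := fun _ _ => rfl } 1
    (fun x => (norm_seq_le x j).trans_eq (one_mul _).symm)

/-- The set of admissible sums of `m` humps in the gliding hump argument: the terms stay below
`2 * M` and the linear `p`-variation is at most `m * K`. -/
def IsHumpSum (M K : ℝ) (m : ℕ) (w : JamesSpace p) : Prop :=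
  (∃ b < 2 * M, ∀ j, ‖w.seq j‖ ≤ b) ∧ LinVariationLE p w.seq (m * K)

/-- Adding a hump of norm at most `M` that is small on the essential support of `w` raises the
`p`-th power of the variation by a constant: only one index step meets both. -/
theorem IsHumpSum.eventually_add {ι : Type*} {l : Filter ι} {u : ι → JamesSpace p} {M : ℝ}
    (hM0 : 0 < M) (hM : ∀ i, ‖u i‖ ≤ M) (hu : ∀ j, Tendsto (fun i => (u i).seq j) l (𝓝 0))
    {m : ℕ} {w : JamesSpace p}
    (hmw : IsHumpSum M (1 + (4 * M) ^ p + 2 ^ p * (1 + 2 * M ^ p)) m w) :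
    ∀ᶠ i in l, ∀ c : ℂ, ‖c‖ = 1 →
      IsHumpSum M (1 + (4 * M) ^ p + 2 ^ p * (1 + 2 * M ^ p)) (m + 1) (w + c • u i) := by
  have hp0 : 0 < p := one_pos.trans hp.out
  set K : ℝ := 1 + (4 * M) ^ p + 2 ^ p * (1 + 2 * M ^ p) with hK
  have hK0 : 0 ≤ K := by positivity
  obtain ⟨⟨b, hb, hwb⟩, hw⟩ := hmw
  -- `b + ε` and `M + ε` are both below `2 * M`
  obtain ⟨ε, hε, hεb, hεM⟩ : ∃ ε > 0, b + ε < 2 * M ∧ M + ε < 2 * M := by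
    refine ⟨min ((2 * M - b) / 2) (M / 2), by
      refine lt_min ?_ ?_ <;> linarith, ?_, ?_⟩
    · have := min_le_left ((2 * M - b) / 2) (M / 2)
      linarith
    · have := min_le_right ((2 * M - b) / 2) (M / 2)
      linarith
  obtain ⟨N₁, hN₁⟩ := hw.exists_tail one_pos
  obtain ⟨N₂, hN₂⟩ := Metric.tendsto_atTop.1 w.tendsto_seq ε hε
  set N := max N₁ N₂
  have hsmall : ∀ᶠ i in l, ∀ j ∈ Finset.range N, ‖(u i).seq j‖ ≤ ε :=
    (Filter.eventually_all_finset _).2 fun j _ =>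
      ((hu j).norm.eventually_lt_const (by simpa using hε)).mono fun _ => le_of_lt
  filter_upwards [hsmall, eventually_linVariation_add_le hp0.le hw hu N] with i hi hlow c hc
  have hsup : ∀ j, ‖(w + c • u i).seq j‖ ≤ max (b + ε) (M + ε) := by
    intro j
    have h1 : ‖(w + c • u i).seq j‖ ≤ ‖w.seq j‖ + ‖(u i).seq j‖ := by
      refine (norm_add_le (w.seq j) (c • (u i).seq j)).trans ?_
      rw [norm_smul, hc, one_mul]
    rcases lt_or_ge j N with hj | hj
    · refine h1.trans (le_max_of_le_left ?_)
      exact add_le_add (hwb j) (hi j (Finset.mem_range.2 hj))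
    · refine h1.trans (le_max_of_le_right ?_)
      rw [add_comm]
      refine add_le_add ((norm_seq_le _ j).trans (hM i)) ?_
      have := hN₂ j ((le_max_right _ _).trans hj)
      rw [dist_zero_right] at this
      exact this.le
  have hmax : max (b + ε) (M + ε) < 2 * M := max_lt hεb hεM
  refine ⟨⟨_, hmax, hsup⟩, ?_⟩
  have hsplit := linVariationLE_of_split (p := p) (x := (w + c • u i).seq)
    (A := m * K + 1) (D := (4 * M) ^ p) (B := 2 ^ p * (1 + 2 * M ^ p)) N
    (by positivity) (by positivity) (hlow c hc) ?_ ?_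
  · refine fun k hk n => (hsplit k hk n).trans (le_of_eq ?_)
    push_cast
    rw [hK]
    ring
  · intro s t
    refine Real.rpow_le_rpow (norm_nonneg _) ((norm_sub_le _ _).trans ?_) hp0.le
    linarith [hsup s, hsup t]
  · intro k hk hk0 n
    refine (linVariation_add_le hp0.le k n).trans ?_
    gcongr
    · exact hN₁ k hk ((le_max_left _ _).trans hk0) n
    · have h1 := (c • u i).linVariationLE k hk n
      refine h1.trans ?_
      gcongr
      rw [norm_smul, hc, one_mul]
      exact hM i

theorem tendsto_rpow_div_zero {K : ℝ} (hK : 0 ≤ K) :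
    Tendsto (fun m : ℕ => (m * K) ^ (1 / p) / m) atTop (𝓝 0) := by
  have h1 : Tendsto (fun m : ℕ => K ^ (1 / p) * (m : ℝ) ^ (-(1 - 1 / p))) atTop
      (𝓝 (K ^ (1 / p) * 0)) := by
    refine ((tendsto_rpow_neg_atTop ?_).comp tendsto_natCast_atTop_atTop).const_mul _
    rw [sub_pos, div_lt_one (one_pos.trans hp.out)]
    exact hp.out
  rw [mul_zero] at h1
  refine h1.congr' ?_
  filter_upwards [eventually_gt_atTop 0] with m hm
  have hm' : (0 : ℝ) < m := by exact_mod_cast hm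
  rw [Real.mul_rpow hm'.le hK, neg_sub, Real.rpow_sub hm', Real.rpow_one]
  ring

/-- The unit vector basis of the James space is shrinking: a bounded family that tends to zero
coordinatewise tends to zero weakly. Indeed a sum of `m` consecutive humps has norm of order
`m ^ (1 / p)`, which is `o(m)` because `p > 1`. -/
theorem tendsto_zero_of_coord {ι : Type*} {l : Filter ι} {u : ι → JamesSpace p} {M : ℝ}
    (hM0 : 0 < M) (hM : ∀ i, ‖u i‖ ≤ M) (hu : ∀ j, Tendsto (fun i => (u i).seq j) l (𝓝 0))
    (f : JamesSpace p →L[ℂ] ℂ) : Tendsto (fun i => f (u i)) l (𝓝 0) := by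
  have hp0 : 0 < p := one_pos.trans hp.out
  refine tendsto_zero_of_gliding_hump (IsHumpSum M (1 + (4 * M) ^ p + 2 ^ p * (1 + 2 * M ^ p)))
    (tendsto_rpow_div_zero (p := p) (by positivity)) ?_
    (fun m w h => h.eventually_add hM0 hM hu)
    (fun m w h => norm_le_of_linVariationLE h.2) f
  refine ⟨⟨0, by positivity, fun j => by simp [seq_zero]⟩, fun k _ n => ?_⟩
  simp [linVariation, seq_zero, Real.zero_rpow hp0.ne']

/-! ### The character on the operators on the James space -/

theorem linVariationLE_initial (n : ℕ) :
    LinVariationLE p (fun i => if i ≤ n then 1 else 0) 1 := by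
  intro k hk m
  have hp0 : 0 < p := one_pos.trans hp.out
  -- every step is `0` or `1`, and equals the drop of the sequence, so the sum telescopes
  let s : ℕ → ℝ := fun i => if k i ≤ n then 1 else 0
  have hterm : ∀ i, ‖(if k (i + 1) ≤ n then (1 : ℂ) else 0) - (if k i ≤ n then 1 else 0)‖ ^ p
      = s i - s (i + 1) := by
    intro i
    have hlt : k i < k (i + 1) := hk i.lt_succ_self
    by_cases h1 : k (i + 1) ≤ n
    · simp [s, h1, hlt.le.trans h1, Real.zero_rpow hp0.ne']
    · by_cases h2 : k i ≤ n <;> simp [s, h1, h2, Real.zero_rpow hp0.ne']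
  simp only [linVariation]
  rw [Finset.sum_congr rfl fun i _ => hterm i, Finset.sum_range_sub']
  have h0 : s 0 ≤ 1 := by simp only [s]; split_ifs <;> norm_num
  have h1 : 0 ≤ s m := by simp only [s]; split_ifs <;> norm_num
  linarith

/-- The indicator of `{0, …, n}`, an initial partial sum of the unit vector basis. -/
noncomputable def initial (p : ℝ) [Fact (1 < p)] (n : ℕ) : JamesSpace p :=
  mk (fun i => if i ≤ n then 1 else 0)
    (tendsto_const_nhds.congr' ((eventually_gt_atTop n).mono fun i hi => by
      simp [not_le.2 hi]))
    (linVariationLE_initial n)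

theorem norm_initial_le (n : ℕ) : ‖initial p n‖ ≤ 1 := by
  have h := norm_le_of_linVariationLE (x := initial p n) (linVariationLE_initial n)
  rwa [Real.one_rpow] at h

theorem tendsto_seq_initial (j : ℕ) : Tendsto (fun n => (initial p n).seq j) atTop (𝓝 1) :=
  tendsto_const_nhds.congr' ((eventually_ge_atTop j).mono fun n hn => by
    simp [initial, seq_mk, hn])

theorem exists_tendsto_initial (f : JamesSpace p →L[ℂ] ℂ) :
    ∃ a, Tendsto (fun n => f (initial p n)) atTop (𝓝 a) := by
  refine cauchySeq_tendsto_of_complete ?_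
  rw [CauchySeq, cauchy_map_iff]
  refine ⟨inferInstance, ?_⟩
  rw [uniformity_eq_comap_nhds_zero, tendsto_comap_iff]
  have h := tendsto_zero_of_coord (p := p) (l := (atTop : Filter ℕ) ×ˢ (atTop : Filter ℕ))
    (u := fun q => initial p q.2 - initial p q.1) (M := 1 + 1)
    (by norm_num)
    (fun q => (norm_sub_le _ _).trans (add_le_add (norm_initial_le _) (norm_initial_le _)))
    (fun j => by
      have h := ((tendsto_seq_initial (p := p) j).comp tendsto_snd).sub
        ((tendsto_seq_initial (p := p) j).comp
          (tendsto_fst (f := (atTop : Filter ℕ)) (g := (atTop : Filter ℕ))))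
      rw [sub_self] at h
      exact h) f
  refine h.congr fun q => ?_
  simp

/-- The James space has codimension one in its bidual, the sequence `(1, 1, …)` spanning a
complement. Operators on the bidual that come from the space therefore act on the quotient line
by a scalar. -/
theorem exists_character : Nonempty ((JamesSpace p →L[ℂ] JamesSpace p) →ₐ[ℂ] ℂ) := by
  have hp0 : 0 < p := one_pos.trans hp.out
  refine exists_character_of_weak_limits atTop (initial p) exists_tendsto_initial ?_ ?_
  · intro z
    by_contra! h
    have h1 : ∀ j, z.seq j = 1 := fun j =>
      tendsto_nhds_unique (h (coord p j)) (tendsto_seq_initial (p := p) j)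
    have h2 := z.tendsto_seq
    rw [show z.seq = fun _ => 1 from funext h1] at h2
    exact one_ne_zero (tendsto_nhds_unique tendsto_const_nhds h2)
  · intro T
    have hbound : ∀ n, ‖T (initial p n)‖ ≤ ‖T‖ := fun n =>
      T.unit_le_opNorm _ (norm_initial_le n)
    -- `y` is the sequence of coordinates of `T** Λ`; it has bounded `p`-variation, hence a limit
    choose y hy using fun j : ℕ => exists_tendsto_initial (p := p) ((coord p j).comp T)
    have hyvar : LinVariationLE p y (2 * ‖T‖ ^ p) :=
      LinVariationLE.of_tendsto (u := fun n => (T (initial p n)).seq) hp0.le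
        (fun n k hk m => ((T (initial p n)).linVariationLE k hk m).trans (by
          gcongr
          exact hbound n)) hy
    obtain ⟨c, hc⟩ := hyvar.exists_tendsto hp0
    have hc0 : Tendsto (fun j => y j - c) atTop (𝓝 0) := by
      simpa using hc.sub_const c
    let z : JamesSpace p := mk _ hc0 (hyvar.sub_const c)
    refine ⟨c, z, fun f => tendsto_zero_of_coord (M := ‖T‖ + ‖c‖ + ‖z‖ + 1) (by positivity)
      (fun n => ?_) (fun j => ?_) f⟩
    · refine le_add_of_le_of_nonneg ?_ zero_le_one
      refine (norm_sub_le _ _).trans (add_le_add_left ((norm_sub_le _ _).trans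
        (add_le_add (hbound n) ?_)) _)
      rw [norm_smul]
      exact mul_le_of_le_one_right (norm_nonneg _) (norm_initial_le n)
    · have h := ((hy j).sub ((tendsto_seq_initial (p := p) j).const_mul c)).sub_const (z.seq j)
      rw [show y j - c * 1 - z.seq j = 0 by simp [z, seq_mk]] at h
      exact h

/-! ### The shift on the James space -/

theorem linVariationLE_tail (x : JamesSpace p) :
    LinVariationLE p (fun i => x.seq (i + 1)) (2 * ‖x‖ ^ p) := fun k hk n =>
  x.linVariationLE (fun i => k i + 1) (fun _ _ h => Nat.succ_lt_succ (hk h)) n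

/-- Splitting off the first coordinate. -/
noncomputable def uncons (p : ℝ) [Fact (1 < p)] : JamesSpace p →L[ℂ] JamesSpace p × ℂ :=
  ContinuousLinearMap.prod
    (LinearMap.mkContinuous
      { toFun := fun x => mk (fun i => x.seq (i + 1))
          (x.tendsto_seq.comp (tendsto_add_atTop_nat 1)) x.linVariationLE_tail
        map_add' := fun _ _ => rfl
        map_smul' := fun _ _ => rfl } 1
      (fun x => by
        rw [one_mul]
        refine norm_le_of_variation_le fun n k hk => ?_
        exact variation_le x (k := fun i => k i + 1) fun _ _ h => Nat.succ_lt_succ (hk h)))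
    (coord p 0)

theorem uncons_snd (x : JamesSpace p) : (uncons p x).2 = x.seq 0 := rfl

theorem exists_uncons_eq (y : JamesSpace p) (c : ℂ) : ∃ x, uncons p x = (y, c) := by
  have hp0 : 0 < p := one_pos.trans hp.out
  let x : ℕ → ℂ := fun i => Nat.casesOn i c y.seq
  have hx0 : Tendsto x atTop (𝓝 0) := (tendsto_add_atTop_iff_nat 1).1 y.tendsto_seq
  have hsup : ∀ i, ‖x i‖ ≤ ‖y‖ + ‖c‖ := by
    intro i
    cases i with
    | zero => exact le_add_of_nonneg_left (norm_nonneg y)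
    | succ i => exact (norm_seq_le y i).trans (le_add_of_nonneg_right (norm_nonneg c))
  have hvar : LinVariationLE p x (0 + (2 * (‖y‖ + ‖c‖)) ^ p + 2 * ‖y‖ ^ p) := by
    refine linVariationLE_of_split 1 le_rfl (by positivity) ?_ ?_ ?_
    · intro k hk n hn
      have h1 := hn n le_rfl
      have h2 := hk.id_le n
      obtain rfl : n = 0 := by simp only [id] at h2; omega
      simp [linVariation]
    · intro i j
      refine Real.rpow_le_rpow (norm_nonneg _) ((norm_sub_le _ _).trans ?_) hp0.le
      linarith [hsup i, hsup j]
    · intro k hk hk0 n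
      have hpos : ∀ i, 1 ≤ k i := fun i => hk0.trans (hk.monotone i.zero_le)
      refine le_trans (le_of_eq (Finset.sum_congr rfl fun i _ => ?_))
        (y.linVariationLE (fun i => k i - 1) (fun i j h => by
          have := hk h
          have := hpos i
          dsimp only
          omega) n)
      have hxk : ∀ i, x (k i) = y.seq (k i - 1) := fun i => by
        obtain ⟨t, ht⟩ := Nat.exists_eq_add_of_le' (hpos i)
        rw [ht]
        rfl
      rw [hxk, hxk]
  exact ⟨mk x hx0 hvar, rfl⟩

theorem exists_equiv_prod : Nonempty (JamesSpace p ≃L[ℂ] JamesSpace p × ℂ) := by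
  refine ⟨ContinuousLinearEquiv.ofBijective (uncons p) ?_ ?_⟩
  · refine LinearMap.ker_eq_bot'.2 fun x hx => ext fun i => ?_
    cases i with
    | zero => exact (uncons_snd x).symm.trans (congrArg Prod.snd hx)
    | succ i =>
      have h := congrArg (fun q : JamesSpace p × ℂ => q.1.seq i) hx
      exact h
  · exact LinearMap.range_eq_top.2 fun q => exists_uncons_eq q.1 q.2

end JamesSpace

/-! ### Continuous functions on compact well-orders with a top of uncountable cofinality -/

section WellOrder

open Set

theorem Filter.Tendsto.eventually_eq_of_countableInterFilter {ι : Type*} {l : Filter ι}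
    [CountableInterFilter l] {g : ι → ℂ} {a : ℂ} (h : Tendsto g l (𝓝 a)) :
    ∀ᶠ i in l, g i = a := by
  have h1 : ∀ᶠ i in l, ∀ n : ℕ, dist (g i) a < 1 / (n + 1) :=
    eventually_countable_forall.2 fun n => Metric.tendsto_nhds.1 h _ (by positivity)
  filter_upwards [h1] with i hi
  refine dist_le_zero.1 (ge_of_tendsto' tendsto_one_div_add_atTop_nhds_zero_nat fun n => (hi n).le)

section

variable {K : Type*} [LinearOrder K] [TopologicalSpace K] [OrderTopology K] [WellFoundedLT K]

theorem isClopen_Ioi_of_wellFoundedLT (b : K) : IsClopen (Ioi b) := by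
  refine ⟨?_, isOpen_Ioi⟩
  rw [← isOpen_compl_iff, compl_Ioi]
  by_cases h : (Ioi b).Nonempty
  · have hmin := WellFounded.min_mem (wellFounded_lt : WellFounded (· < · : K → K → Prop)) _ h
    convert isOpen_Iio (a := WellFounded.min wellFounded_lt (Ioi b) h) using 1
    ext x
    refine ⟨fun hx => lt_of_le_of_lt hx hmin, fun hx => not_lt.1 fun hbx => ?_⟩
    exact WellFounded.not_lt_min wellFounded_lt (Ioi b) hbx hx
  · rw [show Iic b = univ by rw [← compl_Ioi, not_nonempty_iff_eq_empty.1 h, compl_empty]]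
    exact isOpen_univ

/-- The indicator function of the final segment above `b`. -/
noncomputable def tailIndicator (b : K) : C(K, ℂ) where
  toFun := (Ioi b).indicator fun _ => 1
  continuous_toFun := continuous_const.indicator
    (by simp [(isClopen_Ioi_of_wellFoundedLT b).frontier_eq])

theorem tailIndicator_of_le {b j : K} (h : j ≤ b) : tailIndicator b j = 0 :=
  indicator_of_notMem (s := Ioi b) (not_lt.2 h) fun _ => 1

theorem tailIndicator_of_lt {b j : K} (h : b < j) : tailIndicator b j = 1 :=
  indicator_of_mem (s := Ioi b) h fun _ => 1

theorem norm_tailIndicator_le [CompactSpace K] (b : K) : ‖tailIndicator b‖ ≤ 1 := by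
  refine (ContinuousMap.norm_le _ zero_le_one).2 fun x => ?_
  rcases le_or_gt x b with h | h
  · simp [tailIndicator_of_le h]
  · simp [tailIndicator_of_lt h]

end

/-- Weak convergence to zero in `C(K)` of bounded families whose members eventually vanish at the
top and on each proper initial segment. Sums of humps with consecutive supports stay bounded. -/
theorem ContinuousMap.tendsto_zero_of_eventually_zero {K : Type*} [LinearOrder K] [OrderTop K]
    [TopologicalSpace K] [OrderTopology K] [CompactSpace K] [NeBot (𝓝[<] (⊤ : K))] {ι : Type*}
    {l : Filter ι} {u : ι → C(K, ℂ)} {M : ℝ} (hM0 : 0 < M) (hM : ∀ i, ‖u i‖ ≤ M)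
    (htop : ∀ᶠ i in l, u i ⊤ = 0) (hu : ∀ b < ⊤, ∀ᶠ i in l, ∀ j ≤ b, u i j = 0)
    (f : C(K, ℂ) →L[ℂ] ℂ) : Tendsto (fun i => f (u i)) l (𝓝 0) := by
  refine tendsto_zero_of_gliding_hump (fun _ w => w ⊤ = 0 ∧ ‖w‖ ≤ 2 * M) (B := fun _ => 2 * M)
    (tendsto_const_div_atTop_nhds_zero_nat _) ⟨rfl, by simpa using hM0.le⟩ ?_
    (fun _ _ h => h.2) f
  rintro m w ⟨hw0, hw⟩
  have hnear : {x | ‖w x‖ < M} ∈ 𝓝 (⊤ : K) := by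
    refine w.continuous.norm.continuousAt.eventually_lt_const ?_
    simpa [hw0] using hM0
  obtain ⟨b₀, hb₀⟩ : (Iio (⊤ : K)).Nonempty :=
    Filter.nonempty_of_mem (self_mem_nhdsWithin (a := ⊤))
  obtain ⟨b, hb, hbw⟩ := exists_Ioc_subset_of_mem_nhds hnear ⟨b₀, hb₀⟩
  filter_upwards [htop, hu b hb] with i hi0 hi c hc
  refine ⟨by simp [hw0, hi0], (ContinuousMap.norm_le _ (by positivity)).2 fun x => ?_⟩
  rw [ContinuousMap.add_apply, ContinuousMap.smul_apply]
  rcases le_or_gt x b with hx | hx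
  · rw [hi x hx, smul_zero, add_zero]
    exact (w.norm_coe_le_norm x).trans hw
  · refine (norm_add_le _ _).trans ?_
    rw [norm_smul, hc, one_mul, two_mul]
    exact add_le_add (le_of_lt (hbw ⟨hx, le_top⟩)) (((u i).norm_coe_le_norm x).trans (hM i))

variable {K : Type*} [LinearOrder K] [OrderTop K] [TopologicalSpace K] [OrderTopology K]

theorem exists_lt_lt_top [NeBot (𝓝[<] (⊤ : K))] {b : K} (hb : b < ⊤) : ∃ c, b < c ∧ c < ⊤ :=
  (Filter.nonempty_of_mem (Ioo_mem_nhdsLT hb) :)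

/-- A function that is continuous below a top element of uncountable cofinality has a limit there.
Otherwise one finds interlaced increasing sequences along which the values stay apart,
contradicting continuity at their common supremum. -/
theorem exists_tendsto_nhdsLT_top [WellFoundedLT K] [NeBot (𝓝[<] (⊤ : K))]
    [CountableInterFilter (𝓝[<] (⊤ : K))] {g : K → ℂ} (hg : ∀ j < ⊤, ContinuousAt g j) :
    ∃ L, Tendsto g (𝓝[<] ⊤) (𝓝 L) := by
  refine CompleteSpace.complete (f := map g (𝓝[<] (⊤ : K)))
    (Metric.cauchy_iff.2 ⟨inferInstance, ?_⟩)
  by_contra! h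
  obtain ⟨ε, hε, h⟩ := h
  have hex : ∀ b : Iio (⊤ : K), ∃ q : K × K, q.1 ∈ Ioo b.1 ⊤ ∧ q.2 ∈ Ioo b.1 ⊤ ∧
      ε ≤ dist (g q.1) (g q.2) := by
    intro b
    obtain ⟨_, ⟨j, hj, rfl⟩, _, ⟨j', hj', rfl⟩, hd⟩ :=
      h (g '' Ioo b.1 ⊤) (image_mem_map (Ioo_mem_nhdsLT b.2))
    exact ⟨(j, j'), hj, hj', hd⟩
  choose q hq1 hq2 hqd using hex
  obtain ⟨b₀, hb₀⟩ : (Iio (⊤ : K)).Nonempty :=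
    Filter.nonempty_of_mem (self_mem_nhdsWithin (a := ⊤))
  let β : ℕ → Iio (⊤ : K) := fun n => Nat.rec ⟨b₀, hb₀⟩
    (fun _ b => ⟨max (q b).1 (q b).2, max_lt (hq1 b).2 (hq2 b).2⟩) n
  have hβ : ∀ n, (β (n + 1)).1 = max (q (β n)).1 (q (β n)).2 := fun _ => rfl
  have hmono : Monotone fun n => (β n).1 := monotone_nat_of_le_succ fun n => by
    rw [hβ]
    exact (hq1 (β n)).1.le.trans (le_max_left _ _)
  -- the sequence `β` is bounded below `⊤`, so its supremum `s` is a point of continuity of `g`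
  obtain ⟨a, ha, ha_lt⟩ : ∃ a, (∀ n, (β n).1 < a) ∧ a < ⊤ :=
    ((eventually_countable_forall.2 fun n => (Ioo_mem_nhdsLT (β n).2 :
      ∀ᶠ x in 𝓝[<] (⊤ : K), x ∈ Ioo (β n).1 ⊤)).and self_mem_nhdsWithin).exists.imp
      fun a ha => ⟨fun n => (ha.1 n).1, ha.2⟩
  have hne : {x : K | ∀ n, (β n).1 ≤ x}.Nonempty := ⟨a, fun n => (ha n).le⟩
  obtain ⟨s, hs, hsmin⟩ : ∃ s, (∀ n, (β n).1 ≤ s) ∧ ∀ x, (∀ n, (β n).1 ≤ x) → s ≤ x :=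
    ⟨WellFounded.min wellFounded_lt _ hne, WellFounded.min_mem wellFounded_lt _ hne,
      fun x hx => not_lt.1
        (WellFounded.not_lt_min wellFounded_lt {x : K | ∀ n, (β n).1 ≤ x} hx)⟩
  have hs_lt : s < ⊤ := (hsmin a fun n => (ha n).le).trans_lt ha_lt
  have hlim : Tendsto (fun n => (β n).1) atTop (𝓝 s) := by
    refine tendsto_atTop_isLUB hmono ⟨?_, fun x hx => hsmin x fun n => hx ⟨n, rfl⟩⟩
    rintro _ ⟨n, rfl⟩
    exact hs n
  have hlim' := hlim.comp (tendsto_add_atTop_nat 1)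
  have hl1 : Tendsto (fun n => (q (β n)).1) atTop (𝓝 s) :=
    tendsto_of_tendsto_of_tendsto_of_le_of_le hlim hlim' (fun n => (hq1 (β n)).1.le)
      (fun n => (le_max_left _ _).trans (hβ n).ge)
  have hl2 : Tendsto (fun n => (q (β n)).2) atTop (𝓝 s) :=
    tendsto_of_tendsto_of_tendsto_of_le_of_le hlim hlim' (fun n => (hq2 (β n)).1.le)
      (fun n => (le_max_right _ _).trans (hβ n).ge)
  have hd := ((hg s hs_lt).tendsto.comp hl1).dist ((hg s hs_lt).tendsto.comp hl2)
  rw [dist_self] at hd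
  exact absurd (ge_of_tendsto' hd fun n => hqd (β n)) (not_le.2 hε)

variable [CompactSpace K] [WellFoundedLT K] [NeBot (𝓝[<] (⊤ : K))]
  [CountableInterFilter (𝓝[<] (⊤ : K))]

theorem exists_eventually_apply_tailIndicator_eq (f : C(K, ℂ) →L[ℂ] ℂ) :
    ∃ a, ∀ᶠ b in 𝓝[<] (⊤ : K), f (tailIndicator b) = a := by
  have hcauchy : Cauchy (map (fun b : K => f (tailIndicator b)) (𝓝[<] ⊤)) := by
    rw [cauchy_map_iff]
    refine ⟨inferInstance, ?_⟩
    rw [uniformity_eq_comap_nhds_zero, tendsto_comap_iff]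
    have h := ContinuousMap.tendsto_zero_of_eventually_zero (K := K)
      (l := 𝓝[<] (⊤ : K) ×ˢ 𝓝[<] (⊤ : K))
      (u := fun q => tailIndicator q.2 - tailIndicator q.1) (M := 1 + 1) (by norm_num)
      (fun q => (norm_sub_le _ _).trans
        (add_le_add (norm_tailIndicator_le _) (norm_tailIndicator_le _)))
      (by
        have h1 : ∀ᶠ b in 𝓝[<] (⊤ : K), b < ⊤ := self_mem_nhdsWithin
        filter_upwards [h1.prod_mk h1] with q hq
        simp [tailIndicator_of_lt hq.1, tailIndicator_of_lt hq.2])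
      (fun b hb => by
        have h1 : ∀ᶠ a in 𝓝[<] (⊤ : K), a ∈ Ioo b ⊤ := Ioo_mem_nhdsLT hb
        filter_upwards [h1.prod_mk h1] with q hq j hj
        simp [tailIndicator_of_le (hj.trans hq.1.1.le), tailIndicator_of_le (hj.trans hq.2.1.le)])
      f
    refine h.congr fun q => ?_
    simp
  obtain ⟨a, ha⟩ := CompleteSpace.complete hcauchy
  exact ⟨a, Tendsto.eventually_eq_of_countableInterFilter ha⟩

/-- Let `K` be a compact well-order whose proper initial segments are countable and whose top has
uncountable cofinality. The weak limit of the indicators of final segments is the functional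
`μ ↦ μ {⊤}` on measures, that is, the function `1_{⊤}` in the bidual of `C(K)`. For an operator
`T`, the function `g = T** 1_{⊤}` agrees with a continuous function on each proper initial
segment, so it is continuous below `⊤` and has a limit `L` there; hence `T** 1_{⊤}` differs from
`(g ⊤ - L) • 1_{⊤}` by an element of `C(K)`. -/
theorem ContinuousMap.exists_character (hK : ∀ b < (⊤ : K), (Iic b).Countable) :
    Nonempty ((C(K, ℂ) →L[ℂ] C(K, ℂ)) →ₐ[ℂ] ℂ) := by
  have hlt : ∀ᶠ b in 𝓝[<] (⊤ : K), b < ⊤ := self_mem_nhdsWithin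
  refine exists_character_of_weak_limits (𝓝[<] (⊤ : K)) tailIndicator (fun f => ?_)
    (fun z => ?_) (fun T => ?_)
  · obtain ⟨a, ha⟩ := exists_eventually_apply_tailIndicator_eq f
    exact ⟨a, tendsto_const_nhds.congr' (ha.mono fun _ h => h.symm)⟩
  · by_contra! h
    have h0 : ∀ j < ⊤, z j = 0 := fun j hj => by
      refine tendsto_nhds_unique (h (ContinuousMap.evalCLM ℂ j)) (tendsto_const_nhds.congr' ?_)
      filter_upwards [Ioo_mem_nhdsLT hj] with b hb
      exact (tailIndicator_of_le hb.1.le).symm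
    have h1 : z ⊤ = 1 := by
      refine tendsto_nhds_unique (h (ContinuousMap.evalCLM ℂ ⊤)) (tendsto_const_nhds.congr' ?_)
      filter_upwards [hlt] with b hb
      exact (tailIndicator_of_lt hb).symm
    have h2 : Tendsto z (𝓝[<] ⊤) (𝓝 (z ⊤)) :=
      z.continuous.continuousAt.mono_left nhdsWithin_le_nhds
    have h3 : z ⊤ = 0 := tendsto_nhds_unique h2 (tendsto_const_nhds.congr'
      (hlt.mono fun b hb => (h0 b hb).symm))
    exact one_ne_zero (h1.symm.trans h3)
  · choose g hg using fun j : K =>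
      exists_eventually_apply_tailIndicator_eq ((ContinuousMap.evalCLM ℂ j).comp T)
    -- countably many values are attained at a common stage, so `g = T** Λ` agrees with a
    -- continuous function on each proper initial segment
    have hinit : ∀ b < ⊤, ∀ᶠ a in 𝓝[<] (⊤ : K), ∀ j ≤ b, T (tailIndicator a) j = g j :=
      fun b hb => (eventually_countable_ball (hK b hb)).2 fun j _ => hg j
    have hgc : ∀ j < ⊤, ContinuousAt g j := by
      intro j hj
      obtain ⟨b, hjb, hb⟩ := exists_lt_lt_top hj
      obtain ⟨a, ha⟩ := (hinit b hb).exists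
      refine (T (tailIndicator a)).continuous.continuousAt.congr ?_
      filter_upwards [Iio_mem_nhds hjb] with x hx
      exact ha x (le_of_lt hx)
    obtain ⟨L, hL⟩ := exists_tendsto_nhdsLT_top hgc
    let z : C(K, ℂ) :=
      { toFun := Function.update g ⊤ L
        continuous_toFun := by
          refine continuous_iff_continuousAt.2 fun j => ?_
          rcases eq_or_ne j ⊤ with rfl | hj
          · rw [continuousAt_update_same, ← Iio_top]
            exact hL
          · exact (continuousAt_update_of_ne hj).2 (hgc j hj.lt_top) }
    have hz : ∀ j < ⊤, z j = g j := fun j hj => Function.update_of_ne hj.ne _ _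
    have hztop : z ⊤ = L := Function.update_self _ _ _
    refine ⟨g ⊤ - L, z, fun f => ContinuousMap.tendsto_zero_of_eventually_zero
      (M := ‖T‖ + ‖g ⊤ - L‖ + ‖z‖ + 1) (by positivity) (fun a => ?_) ?_ (fun b hb => ?_) f⟩
    · refine le_add_of_le_of_nonneg ?_ zero_le_one
      refine (norm_sub_le _ _).trans (add_le_add_left ((norm_sub_le _ _).trans
        (add_le_add (T.unit_le_opNorm _ (norm_tailIndicator_le a)) ?_)) _)
      rw [norm_smul]
      exact mul_le_of_le_one_right (norm_nonneg _) (norm_tailIndicator_le a)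
    · filter_upwards [hg ⊤, hlt] with a ha ha_lt
      have ha' : T (tailIndicator a) ⊤ = g ⊤ := ha
      simp [ha', tailIndicator_of_lt ha_lt, hztop]
    · filter_upwards [hinit b hb, Ioo_mem_nhdsLT hb] with a ha hab j hj
      simp [ha j hj, tailIndicator_of_le (hj.trans hab.1.le), hz j (hj.trans_lt hb)]

end WellOrder

/-! ### The Semadeni space -/

section Semadeni

open Set

theorem isSuccLimit_omega_one : Order.IsSuccLimit (Ordinal.omega 1) :=
  Cardinal.isSuccLimit_omega 1

instance : Fact ((0 : Ordinal.{0}) ≤ Ordinal.omega 1) := ⟨zero_le⟩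

/-- The ordinal interval `[0, ω₁]`. -/
abbrev OmegaOneInterval : Type 1 := Icc (0 : Ordinal.{0}) (Ordinal.omega 1)

namespace OmegaOneInterval

theorem lt_top_iff {b : OmegaOneInterval} : b < ⊤ ↔ b.1 < Ordinal.omega 1 := Iff.rfl

theorem zero_lt_top : (⟨0, le_rfl, zero_le⟩ : OmegaOneInterval) < ⊤ :=
  Ordinal.omega_pos 1

theorem mem_nhdsLT_top_iff {s : Set OmegaOneInterval} :
    s ∈ 𝓝[<] (⊤ : OmegaOneInterval) ↔ ∃ b < ⊤, Ioo b ⊤ ⊆ s :=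
  mem_nhdsLT_iff_exists_Ioo_subset' zero_lt_top

instance : NeBot (𝓝[<] (⊤ : OmegaOneInterval)) := by
  refine ⟨fun h => ?_⟩
  obtain ⟨b, hb, hsub⟩ := mem_nhdsLT_top_iff.1 (h ▸ mem_bot : ∅ ∈ 𝓝[<] (⊤ : OmegaOneInterval))
  have hlt := isSuccLimit_omega_one.succ_lt (lt_top_iff.1 hb)
  exact hsub (a := ⟨Order.succ b.1, zero_le, hlt.le⟩)
    ⟨(Order.lt_succ b.1 : b.1 < Order.succ b.1), hlt⟩

instance : CountableInterFilter (𝓝[<] (⊤ : OmegaOneInterval)) := by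
  refine ⟨fun S hS hmem => ?_⟩
  choose! b hb hsub using fun s (hs : s ∈ S) => mem_nhdsLT_top_iff.1 (hmem s hs)
  have : Countable S := hS
  have hlt : ⨆ s : S, (b s).1 < Ordinal.omega 1 :=
    Ordinal.iSup_lt_omega_one fun s : S => lt_top_iff.1 (hb s s.2)
  refine mem_nhdsLT_top_iff.2 ⟨⟨_, zero_le, hlt.le⟩, hlt, fun x hx s hs => ?_⟩
  refine hsub s hs ⟨lt_of_le_of_lt ?_ hx.1, hx.2⟩
  exact Ordinal.le_iSup (fun s : S => (b s).1) ⟨s, hs⟩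

theorem countable_Iic {b : OmegaOneInterval} (hb : b < ⊤) : (Iic b).Countable := by
  have hlt : Order.succ b.1 < Ordinal.omega 1 := isSuccLimit_omega_one.succ_lt (lt_top_iff.1 hb)
  have hc : (Iio (Order.succ b.1)).Countable := by
    rw [← Cardinal.le_aleph0_iff_set_countable, Cardinal.mk_Iio_ordinal, Cardinal.lift_le_aleph0]
    rw [Cardinal.lt_omega_iff_card_lt, ← Cardinal.succ_aleph0, Order.lt_succ_iff] at hlt
    exact hlt
  exact (hc.preimage (f := fun x : OmegaOneInterval => x.1) Subtype.val_injective).mono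
    fun x (hx : x.1 ≤ b.1) => Order.lt_succ_iff.2 hx

/-- The order embedding `j ↦ 1 + j` onto the complement of `0`. It maps the interval to itself
because `1 + ω₁ = ω₁`. -/
noncomputable def oneAdd (j : OmegaOneInterval) : OmegaOneInterval :=
  ⟨1 + j.1, zero_le, by
    have h : 1 + Ordinal.omega 1 = Ordinal.omega 1 :=
      Ordinal.one_add_of_omega0_le (Ordinal.omega0_le_omega 1)
    calc 1 + j.1 ≤ 1 + Ordinal.omega 1 := add_le_add_right j.2.2 1
      _ = Ordinal.omega 1 := h⟩

theorem continuous_oneAdd : Continuous oneAdd :=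
  ((Ordinal.isNormal_add_right 1).continuous.comp continuous_subtype_val).subtype_mk _

/-- The interval `[0, ω₁]` consists of `0` and of a copy of itself. -/
noncomputable def sumEquiv : Unit ⊕ OmegaOneInterval ≃ OmegaOneInterval :=
  Equiv.ofBijective (Sum.elim (fun _ => ⟨0, le_rfl, zero_le⟩) oneAdd) (by
    constructor
    · rintro (_ | a) (_ | b) h
      · rfl
      · have h' : (0 : Ordinal) = 1 + b.1 := congrArg Subtype.val h
        exact absurd h'.symm (by simp)
      · have h' : 1 + a.1 = (0 : Ordinal) := congrArg Subtype.val h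
        exact absurd h' (by simp)
      · have h' : 1 + a.1 = 1 + b.1 := congrArg Subtype.val h
        exact congrArg Sum.inr (Subtype.ext (by simpa using h'))
    · rintro ⟨j, hj0, hj⟩
      rcases eq_or_ne j 0 with rfl | hne
      · exact ⟨Sum.inl (), rfl⟩
      · refine ⟨Sum.inr ⟨j - 1, zero_le, (Ordinal.sub_le_self j 1).trans hj⟩, Subtype.ext ?_⟩
        exact Ordinal.add_sub_cancel_of_le (Order.one_le_iff_ne_zero.2 hne))

/-- The bijection `sumEquiv` as a homeomorphism. -/
noncomputable def sumHomeomorph : Unit ⊕ OmegaOneInterval ≃ₜ OmegaOneInterval :=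
  Continuous.homeoOfEquivCompactToT2 (f := sumEquiv) (continuous_const.sumElim continuous_oneAdd)

end OmegaOneInterval

theorem SemadeniSpace.exists_equiv_prod :
    Nonempty (SemadeniSpace ≃L[ℂ] SemadeniSpace × ℂ) := by
  let e := OmegaOneInterval.sumHomeomorph
  let o : OmegaOneInterval := e (Sum.inl ())
  let g : C(OmegaOneInterval, OmegaOneInterval) := ⟨fun j => e (Sum.inr j), by fun_prop⟩
  let A : SemadeniSpace →L[ℂ] SemadeniSpace × ℂ :=
    { toFun := fun f => (f.comp g, f o)
      map_add' := fun _ _ => rfl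
      map_smul' := fun _ _ => rfl
      cont := (ContinuousMap.continuous_precomp g).prodMk (continuous_eval_const o) }
  refine ⟨ContinuousLinearEquiv.ofBijective A ?_ ?_⟩
  · refine LinearMap.ker_eq_bot'.2 fun f hf => ContinuousMap.ext fun j => ?_
    obtain ⟨i, rfl⟩ := e.surjective j
    rcases i with i | i
    · exact congrArg Prod.snd hf
    · exact congrArg (fun q : SemadeniSpace × ℂ => q.1 i) hf
  · refine LinearMap.range_eq_top.2 fun q => ?_
    let h : C(Unit ⊕ OmegaOneInterval, ℂ) :=
      ⟨Sum.elim (fun _ => q.2) q.1, continuous_const.sumElim q.1.continuous⟩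
    refine ⟨h.comp ⟨e.symm, e.symm.continuous⟩, Prod.ext (ContinuousMap.ext fun j => ?_) ?_⟩
    · change h (e.symm (e (Sum.inr j))) = q.1 j
      rw [e.symm_apply_apply]
      rfl
    · change h (e.symm (e (Sum.inl ()))) = q.2
      rw [e.symm_apply_apply]
      rfl

theorem SemadeniSpace.exists_character :
    Nonempty ((SemadeniSpace →L[ℂ] SemadeniSpace) →ₐ[ℂ] ℂ) :=
  ContinuousMap.exists_character fun _ => OmegaOneInterval.countable_Iic

end Semadeni

theorem proposition1p3 :
    (∀ {X : Type*} [NormedAddCommGroup X] [NormedSpace ℂ X] [CompleteSpace X]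
        {Z : Type*} [NormedAddCommGroup Z] [NormedSpace ℂ Z] [CompleteSpace Z] [Nontrivial Z],
      Module.rank ℂ X ≠ 1 →
      ∀ χ : (X →L[ℂ] X) →ₐ[ℂ] ℂ,
        ∃ φ : (X →L[ℂ] X) →ₐ[ℂ] ((X × Z) →L[ℂ] (X × Z)),
          (∀ (T : X →L[ℂ] X) (x : X) (z : Z), φ T (x, z) = (T x, χ T • z)) ∧
          Continuous φ ∧ Function.Injective φ ∧
          φ (ContinuousLinearMap.id ℂ X) = ContinuousLinearMap.id ℂ (X × Z) ∧
          (∀ T : X →L[ℂ] X, IsRankOne T → IsRankOne (φ T)) ∧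
          ¬ Function.Surjective φ) ∧
    (∀ (p : ℝ) [Fact (1 < p)],
      ∃ φ : (JamesSpace p →L[ℂ] JamesSpace p) →ₐ[ℂ] (JamesSpace p →L[ℂ] JamesSpace p),
        Continuous φ ∧ Function.Injective φ ∧
        φ (ContinuousLinearMap.id ℂ (JamesSpace p)) = ContinuousLinearMap.id ℂ (JamesSpace p) ∧
        (∀ T : JamesSpace p →L[ℂ] JamesSpace p, IsRankOne T → IsRankOne (φ T)) ∧
        ¬ Function.Surjective φ) ∧
    (∃ φ : (SemadeniSpace →L[ℂ] SemadeniSpace) →ₐ[ℂ] (SemadeniSpace →L[ℂ] SemadeniSpace),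
      Continuous φ ∧ Function.Injective φ ∧
      φ (ContinuousLinearMap.id ℂ SemadeniSpace) = ContinuousLinearMap.id ℂ SemadeniSpace ∧
      (∀ T : SemadeniSpace →L[ℂ] SemadeniSpace, IsRankOne T → IsRankOne (φ T)) ∧
      ¬ Function.Surjective φ) := by
  refine ⟨fun {X} _ _ _ {Z} _ _ _ _ hX χ => ?_, fun p _ => ?_, ?_⟩
  · exact ⟨diagAlgHom Z χ, diagAlgHom_apply χ, continuous_diagAlgHom χ, injective_diagAlgHom χ,
      map_one _, fun T => isRankOne_diagAlgHom χ hX, not_surjective_diagAlgHom χ⟩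
  · obtain ⟨e⟩ := JamesSpace.exists_equiv_prod (p := p)
    obtain ⟨χ⟩ := JamesSpace.exists_character (p := p)
    exact exists_algHom_of_equiv_prod e χ
  · obtain ⟨e⟩ := SemadeniSpace.exists_equiv_prod
    obtain ⟨χ⟩ := SemadeniSpace.exists_character
    exact exists_algHom_of_equiv_prod e χ
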